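/- Let $q$ be a power of $2$, $\mathbb{A}=\mathbb{F}_q[T]$, $k_0=\mathbb{F}_q(T)$, let $P$ denote monic irreducible polynomials, $|f|=q^{\deg f}$, and $\zeta_{\mathbb{A}}(s)=(1-q^{1-s})^{-1}$. Fix $\xi\in\mathbb{F}_q$ not of the form $x^2+x$ with $x\in\mathbb{F}_q$. **The family.** For $n\ge 1$ let $\mathcal{B}_n$ be the set of monic $M\in\mathbb{A}$ such that $v_P(M)$ is $0$ or odd for every $P$ and $\deg\big(M\prod_{P\mid M}P\big)=2n$. Let $\mathcal{F}_0=\{0\}$ and, for $n\ge1$, let $\mathcal{F}_n$ be the set of all $u\in k_0$ of the form $u=\sum_{P\mid M}\sum_{i=1}^{\ell_P}A_{P,i}/P^{2i-1}$ with $M\in\mathcal{B}_n$, $\ell_P=\tfrac12(v_P(M)+1)$, $A_{P,i}\in\mathbb{A}$, $\deg A_{P,i}<\deg P$ and $A_{P,\ell_P}\ne0$ for all $P\mid M$. For $s\ge1$ let $\mathcal{G}_s$ be the set of polynomials $\alpha+\sum_{i=1}^s\alpha_iT^{2i-1}$ with $\alpha\in\{0,\xi\}$, $\alpha_i\in\mathbb{F}_q$,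 $\alpha_s\neq0$. Put $\mathcal{I}_n=\{u+f:\ u\in\mathcal{F}_r,\ f\in\mathcal{G}_s,\ r\ge0,\ s\ge1,\ r+s=n\}$, a finite set. **The $L$-functions.** For $u\in k_0$ the function $\chi_u$ on monic polynomials is completely multiplicative, with $\chi_u(P)=0$ if $P$ divides the denominator of $u$, and otherwise $\chi_u(P)=1$ or $-1$ according as $x^2+x\equiv u\pmod P$ is solvable in $\mathbb{A}$ or not. For $u\in\mathcal{I}_{g+1}$ let $L(s,\chi_u)=\sum_{n\ge0}q^{-ns}\sum_{f\text{ monic},\,\deg f=n}\chi_u(f)$; this is a polynomial in $q^{-s}$, and is the continuation of $\sum_{f\text{ monic}}\chi_u(f)|f|^{-s}$ from $\Re(s)>1$. **The conjecture.** For an integer $k\ge1$ and small complex $z_1,\dots,z_k$ let $$A\left(\tfrac12;z_1,\dots,z_k\right)=\prod_P\prod_{1\le i\le j\le k}\left(1-\frac1{|P|^{1+z_i+z_j}}\right)\left(\frac12\left(\prod_{j=1}^k\left(1-\frac1{|P|^{\frac12+z_j}}\right)^{-1}+\prod_{j=1}^k\left(1+\frac1{|P|^{\frac12+z_j}}\right)^{-1}\right)+\frac1{|P|}\right)\left(1+\frac1{|P|}\right)^{-1},$$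 $X(s)=q^{-\frac12+s}$, $\Delta(x_1,\dots,x_k)=\prod_{i<j}(x_j-x_i)$, $$G(z_1,\dots,z_k)=A\left(\tfrac12;z_1,\dots,z_k\right)\prod_{j=1}^kX\left(\tfrac12+z_j\right)^{-\frac12}\prod_{1\le i\le j\le k}\zeta_{\mathbb{A}}(1+z_i+z_j),$$ $$Q_k(x)=\frac{(-1)^{k(k-1)/2}2^k}{k!}\frac1{(2\pi i)^k}\oint\cdots\oint\frac{G(z_1,\dots,z_k)\,\Delta(z_1^2,\dots,z_k^2)^2}{\prod_{j=1}^kz_j^{2k-1}}\,q^{\frac x2\sum_{j=1}^kz_j}\,dz_1\cdots dz_k,$$ where each contour is the circle $|z_j|=r$, for a fixed $r$ with $0<r<\min\left(\tfrac14,\pi/\log q\right)$. The $k$-th moment conjecture for $q$ is the assertion $$\sum_{u\in\mathcal{I}_{g+1}}L\left(\tfrac12,\chi_u\right)^k=\sum_{u\in\mathcal{I}_{g+1}}Q_k(2g+1)\,(1+o(1))\qquad(g\to\infty).$$ **Theorem.** For every $k\ge1$ the product $A(\frac12;0,\dots,0)$ converges and, if the $k$-th moment conjecture for $q$ holds, then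 as $g\to\infty$ $$\sum_{u\in\mathcal{I}_{g+1}}L\left(\tfrac12,\chi_u\right)^k\sim2^{\frac{k(k+1)}2+1}\,\frac{q^{2g+1}}{\zeta_{\mathbb{A}}(2)}\,g^{\frac{k(k+1)}2}\,A\left(\tfrac12;0,\dots,0\right)\prod_{j=1}^k\frac{j!}{(2j)!}.$$ In particular, under the conjecture for $k=4$, respectively $k=5$, the fourth, respectively fifth, moment is asymptotic to $$\frac2{4725}\frac{q^{2g+1}}{\zeta_{\mathbb{A}}(2)}g^{10}A\left(\tfrac12;0,0,0,0\right),\qquad\text{respectively}\qquad\frac2{4465125}\frac{q^{2g+1}}{\zeta_{\mathbb{A}}(2)}g^{15}A\left(\tfrac12;0,0,0,0,0\right),$$ and $$A\left(\tfrac12;0,0,0,0\right)=\prod_P\left(1-\frac{h_4(|P|)}{|P|^{10}(|P|+1)}\right),\qquad A\left(\tfrac12;0,0,0,0,0\right)=\prod_P\left(1-\frac{h_5(|P|)}{|P|^{15}(|P|+1)}\right),$$ where $$h_4(x)=30x^9-109x^8+210x^7-274x^6+272x^5-210x^4+119x^3-45x^2+10x-1,$$ $$h_5(x)=65x^{14}-385x^{13}+1220x^{12}-2613x^{11}+4263x^{10}-5725x^9+6540x^8-6275x^7+4879x^6-2963x^5+1360x^4-455x^3+105x^2-15x+1.$$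 -/

import Mathlib

open Polynomial Filter Asymptotics UniqueFactorizationMonoid
open scoped Classical Nat

noncomputable section

namespace EvenCharMoments

variable (F : Type*) [Field F] [Fintype F]

/-- `q`, the number of elements of the constant field. -/
def q : ℕ := Fintype.card F

variable {F}

/-- The norm `|f| = q ^ deg f` of a nonzero polynomial. -/
def pnorm (f : F[X]) : ℕ := q F ^ f.natDegree

/-- The finite set of monic irreducible divisors of a nonzero polynomial. -/
def primeDivisors (M : F[X]) : Finset F[X] := (normalizedFactors M).toFinset

variable (F) in
/-- Monic irreducible polynomials. -/
abbrev MonicPrime : Type _ := {P : F[X] // P.Monic ∧ Irreducible P}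

/-! ### The family of ramified imaginary quadratic extensions -/

/-- `r(M) = ∏_{P ∣ M} P`. -/
def rad (M : F[X]) : F[X] := ∏ P ∈ primeDivisors M, P

/-- `t(M) = M * r(M)`. -/
def tPoly (M : F[X]) : F[X] := M * rad M

variable (F) in
/-- Monic polynomials in which every prime has valuation zero or odd. -/
def calB : Set F[X] :=
  {M | M.Monic ∧ ∀ P : F[X], P.Monic → Irreducible P → multiplicity P M = 0 ∨ Odd (multiplicity P M)}

variable (F) in
/-- `𝓑_n = {M ∈ 𝓑 : deg t(M) = 2n}`. -/
def calBn (n : ℕ) : Set F[X] := {M | M ∈ calB F ∧ (tPoly M).natDegree = 2 * n}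

/-- `ℓ_P = (v_P(M) + 1) / 2`; an exact division for `M ∈ 𝓑` and `P ∣ M`. -/
def ell (M P : F[X]) : ℕ := (multiplicity P M + 1) / 2

/-- The rational functions `∑_{P ∣ M} ∑_{i=1}^{ℓ_P} A_{P,i} / P^{2i-1}` with
`deg A_{P,i} < deg P` and `A_{P,ℓ_P} ≠ 0`. They are reduced fractions with denominator `M`. -/
def calFM (M : F[X]) : Set (RatFunc F) :=
  {u | ∃ A : F[X] → ℕ → F[X],
    (∀ P ∈ primeDivisors M, ∀ i ∈ Finset.Icc 1 (ell M P), (A P i).degree < P.degree) ∧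
    (∀ P ∈ primeDivisors M, A P (ell M P) ≠ 0) ∧
    u = ∑ P ∈ primeDivisors M, ∑ i ∈ Finset.Icc 1 (ell M P),
      algebraMap F[X] (RatFunc F) (A P i) / algebraMap F[X] (RatFunc F) P ^ (2 * i - 1)}

variable (F) in
/-- `𝓕_0 = {0}`, and for `n ≥ 1` the union of the preceding sets over `M ∈ 𝓑_n`. -/
def calF (n : ℕ) : Set (RatFunc F) :=
  if n = 0 then {0} else ⋃ M ∈ calBn F n, calFM M

/-- `𝓖_s`: polynomials `α + ∑_{i=1}^s α_i T^{2i-1}` with `α ∈ {0, ξ}` and `α_s ≠ 0`. -/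
def calG (ξ : F) (s : ℕ) : Set F[X] :=
  {f | ∃ (α : F) (a : ℕ → F), (α = 0 ∨ α = ξ) ∧ a s ≠ 0 ∧
    f = C α + ∑ i ∈ Finset.Icc 1 s, C (a i) * X ^ (2 * i - 1)}

/-- `𝓘_n`: all `u + f` with `u ∈ 𝓕_r`, `f ∈ 𝓖_s`, `r ≥ 0`, `s ≥ 1`, `r + s = n`. -/
def calI (ξ : F) (n : ℕ) : Set (RatFunc F) :=
  {w | ∃ r s : ℕ, 1 ≤ s ∧ r + s = n ∧ ∃ u ∈ calF F r, ∃ f ∈ calG ξ s,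
    w = u + algebraMap F[X] (RatFunc F) f}

/-! ### The quadratic character and its `L`-function -/

/-- The Hasse symbol `[u, P)` for a prime `P` not dividing the denominator of `u`: it is `0` if
`x² + x ≡ u (mod P)` is solvable and `1` otherwise. The congruence is written after multiplication
by the denominator, a unit modulo `P`. -/
def hasse (u : RatFunc F) (P : F[X]) : ZMod 2 :=
  if ∃ x : F[X], P ∣ u.denom * (x ^ 2 + x) - u.num then 0 else 1

/-- `[u, N) = ∑ e_i [u, P_i)` for `N = sgn(N) ∏ P_i^{e_i}`. -/
def hasseSum (u : RatFunc F) (N : F[X]) : ZMod 2 := ((normalizedFactors N).map (hasse u)).sum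

/-- `χ_u(N)`, equal to `(-1)^{[u, N)}` if `N` is prime to the denominator of `u` and `0`
otherwise. -/
def chi (u : RatFunc F) (N : F[X]) : ℤ :=
  if IsCoprime N u.denom then (-1) ^ (hasseSum u N).val else 0

/-- The coefficient `∑_{f monic, deg f = n} χ_u(f)` of `z ^ n` in the `L`-function (a sum over the
finite set of monic polynomials of degree `n`). -/
def lCoeff (u : RatFunc F) (n : ℕ) : ℤ := ∑ᶠ f ∈ {f : F[X] | f.Monic ∧ f.natDegree = n}, chi u f

/-- `L(s, χ_u) = ∑_{f monic} χ_u(f) |f|^{-s}`, with the terms collected by degree. For `u` in the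
family the coefficients vanish beyond degree `2g`, so this is a polynomial in `q^{-s}`, which is the
continuation of the Dirichlet series from `Re s > 1` to all `s`. -/
def L (s : ℂ) (u : RatFunc F) : ℂ := ∑' n : ℕ, (lCoeff u n : ℂ) * ((q F : ℂ) ^ (-s)) ^ n

/-! ### The moment conjecture -/

variable (F) in
/-- The zeta function of `F[T]`, continued to the plane. -/
def zetaA (s : ℂ) : ℂ := (1 - (q F : ℂ) ^ (1 - s))⁻¹

variable (F) in
/-- `X(s) = q^{-1/2+s}`. -/
def X' (s : ℂ) : ℂ := (q F : ℂ) ^ (-(1 / 2 : ℂ) + s)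

/-- `Δ(x_1, …, x_k) = ∏_{i<j} (x_j - x_i)`. -/
def vand {k : ℕ} (x : Fin k → ℂ) : ℂ := ∏ i : Fin k, ∏ j ∈ Finset.Ioi i, (x j - x i)

/-- The factor at `P` of the Euler product `A(1/2; z_1, …, z_k)`. -/
def eulerFactor {k : ℕ} (z : Fin k → ℂ) (P : MonicPrime F) : ℂ :=
  (∏ i : Fin k, ∏ j ∈ Finset.Ici i, (1 - 1 / (pnorm P.1 : ℂ) ^ (1 + z i + z j))) *
    ((1 / 2) * ((∏ j : Fin k, (1 - 1 / (pnorm P.1 : ℂ) ^ (1 / 2 + z j))⁻¹) +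
        ∏ j : Fin k, (1 + 1 / (pnorm P.1 : ℂ) ^ (1 / 2 + z j))⁻¹) + 1 / (pnorm P.1 : ℂ)) *
    (1 + 1 / (pnorm P.1 : ℂ))⁻¹

variable (F) in
/-- The Euler product `A(1/2; z_1, …, z_k)`. -/
def A {k : ℕ} (z : Fin k → ℂ) : ℂ := ∏' P : MonicPrime F, eulerFactor z P

variable (F) in
/-- `G(z) = A(1/2; z) ∏_j X(1/2+z_j)^{-1/2} ∏_{i≤j} ζ_A(1+z_i+z_j)`. -/
def G {k : ℕ} (z : Fin k → ℂ) : ℂ :=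
  A F z * (∏ j : Fin k, X' F (1 / 2 + z j) ^ (-(1 / 2) : ℂ)) *
    ∏ i : Fin k, ∏ j ∈ Finset.Ici i, zetaA F (1 + z i + z j)

variable (F) in
/-- The `k`-fold residue `Q_k(x)`, as an integral over `k` circles of radius `r` about `0`.
(The poles of `G` along `z_i + z_j = 0`, `i < j`, are cancelled by the Vandermonde factor.) -/
def Q (k : ℕ) (r : ℝ) (x : ℂ) : ℂ :=
  (-1) ^ (k * (k - 1) / 2) * 2 ^ k / (k ! : ℂ) * (1 / (2 * (Real.pi : ℂ) * Complex.I) ^ k) *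
    torusIntegral
      (fun z : Fin k → ℂ =>
        G F z * vand (fun j => z j ^ 2) ^ 2 / (∏ j : Fin k, z j ^ (2 * k - 1)) *
          (q F : ℂ) ^ (x / 2 * ∑ j : Fin k, z j))
      0 (fun _ => r)

/-- The `k`-th moment `∑_{u ∈ 𝓘_{g+1}} L(1/2, χ_u)^k` (a finite sum). -/
def moment (ξ : F) (k g : ℕ) : ℂ := ∑ᶠ u ∈ calI ξ (g + 1), L (1 / 2) u ^ k

/-- The `k`-th moment conjecture for the family, with contours of radius `r`:
`∑_u L(1/2, χ_u)^k = ∑_u Q_k(2g+1) (1 + o(1))` as `g → ∞`. -/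
def MomentConjecture (ξ : F) (k : ℕ) (r : ℝ) : Prop :=
  (fun g : ℕ => moment ξ k g) ~[atTop]
    fun g : ℕ => ∑ᶠ _u ∈ calI ξ (g + 1), Q F k r (2 * (g : ℂ) + 1)

/-- The numerator polynomial in the arithmetic factor of the fourth moment. -/
def h4 (x : ℂ) : ℂ :=
  30 * x ^ 9 - 109 * x ^ 8 + 210 * x ^ 7 - 274 * x ^ 6 + 272 * x ^ 5 - 210 * x ^ 4 + 119 * x ^ 3
    - 45 * x ^ 2 + 10 * x - 1

/-- The numerator polynomial in the arithmetic factor of the fifth moment. -/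
def h5 (x : ℂ) : ℂ :=
  65 * x ^ 14 - 385 * x ^ 13 + 1220 * x ^ 12 - 2613 * x ^ 11 + 4263 * x ^ 10 - 5725 * x ^ 9
    + 6540 * x ^ 8 - 6275 * x ^ 7 + 4879 * x ^ 6 - 2963 * x ^ 5 + 1360 * x ^ 4 - 455 * x ^ 3
    + 105 * x ^ 2 - 15 * x + 1

end EvenCharMoments

end

/-! The $L$-functions enter only through the conjecture. Since $Q_k(2g+1)$ does not depend on $u$,
two facts are needed: the exact size of the family, and the growth of $Q_k$.

Growth. Each $\zeta_{\mathbb A}(1+z_i+z_j)$ has a simple pole at $z_i+z_j=0$. For $i<j$ it is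
absorbed by one factor $z_j^2-z_i^2$, leaving $z_j-z_i$; for $i=j$ it adds one to the exponent of
$1/z_i$. The integrand thus becomes a regular factor times $\Delta(z)\Delta(z^2)\prod
e^{cz_j}/z_j^{2k}$ with $c=(g+\frac12)\log q$ (`integrand_eq`). Shrinking the circles to radius
$1/c$ and putting $z=w/c$ extracts $c^{k(k+1)/2}$ by homogeneity (`Q_eq_rescaled`), while the
regular factor freezes at $A(\frac12;0)(\log q)^{-k(k+1)/2}$. As $c\sim g\log q$, the logarithms
cancel. The remaining unit-torus integral is, by Andréief's formula, a determinant of reciprocal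
factorials, which reduces to a Vandermonde determinant (`det_descFactorial`).

This needs $A$ to be continuous, holomorphic in each variable and nonzero at $0$. All of it follows
from a uniform bound $O(|P|^{-2+4r})$ for the Euler factors minus one (`eulerFactor_sub_one_bound`).

Size. Partial fractions identify $\mathcal F_n$ with families of digits whose conductor $\prod
P^{\ell_P}$ has degree $n$. Counting pairs (digit family, monic multiple of its conductor) in two
ways gives a convolution identity (`sum_card_digits`) whose weights are precisely those supplied by
the polynomial parts, whence $|\mathcal I_{g+1}|=2(q-1)q^{2g}=2q^{2g+1}/\zeta_{\mathbb A}(2)$. -/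

namespace EvenCharMoments
-- Torus integrals: Fubini, change of radius, Andréief's formula, dilation.
open MeasureTheory Complex Set Real in
/-- Fubini for torus integrals, with the integral over one chosen circle performed first. -/
theorem torusIntegral_succAbove_inner {n : ℕ}
    {f : (Fin (n + 1) → ℂ) → ℂ} {c : Fin (n + 1) → ℂ} {R : Fin (n + 1) → ℝ}
    (hf : TorusIntegrable f c R) (i : Fin (n + 1)) :
    torusIntegral f c R =
      torusIntegral (fun y => circleIntegral (fun x => f (i.insertNth x y)) (c i) (R i))
        (c ∘ i.succAbove) (R ∘ i.succAbove) := by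
  set e : ℝ × (Fin n → ℝ) ≃ᵐ (Fin (n + 1) → ℝ) :=
    (MeasurableEquiv.piFinSuccAbove (fun _ => ℝ) i).symm
  have hem : MeasurePreserving e :=
    (volume_preserving_piFinSuccAbove (fun _ : Fin (n + 1) => ℝ) i).symm _
  have heπ : (e ⁻¹' Icc 0 fun _ => 2 * π) =
      Icc 0 (2 * π) ×ˢ Icc (0 : Fin n → ℝ) fun _ => 2 * π :=
    ((Fin.insertNthOrderIso (fun _ => ℝ) i).preimage_Icc _ _).trans (Icc_prod_eq _ _)
  have hint := hf.function_integrable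
  rw [← hem.integrableOn_comp_preimage e.measurableEmbedding, heπ, Measure.volume_eq_prod,
    IntegrableOn, ← Measure.prod_restrict] at hint
  rw [torusIntegral, ← hem.map_eq, setIntegral_map_equiv, heπ, Measure.volume_eq_prod,
    ← Measure.prod_restrict]
  refine (integral_prod_symm _ hint).trans ?_
  rw [torusIntegral]
  refine setIntegral_congr_fun measurableSet_Icc fun Θ _ => ?_
  simp only [circleIntegral_def_Icc, ← integral_smul, Function.comp_apply]
  refine setIntegral_congr_fun measurableSet_Icc fun θ _ => ?_
  simp +unfoldPartialApp only [e, deriv_circleMap, i.prod_univ_succAbove _, smul_smul, torusMap,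
    circleMap_zero, MeasurableEquiv.piFinSuccAbove_symm_apply, i.insertNth_apply_same,
    i.insertNth_apply_succAbove, (· ∘ ·), Fin.insertNthEquiv, Equiv.coe_fn_mk]
  rw [mul_comm]
  congr 2
  simp only [funext_iff, i.forall_iff_succAbove, circleMap, Fin.insertNth_apply_same,
    Fin.insertNth_apply_succAbove, imp_true_iff, and_self_iff]

theorem norm_torusMap_zero {n : ℕ} {R : Fin n → ℝ} (hR : ∀ i, 0 ≤ R i) (θ : Fin n → ℝ)
    (i : Fin n) : ‖torusMap 0 R θ i‖ = R i := by
  simp [torusMap, abs_of_nonneg (hR i)]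

theorem continuous_torusMap {n : ℕ} (c : Fin n → ℂ) (R : Fin n → ℝ) :
    Continuous (torusMap c R) := by
  unfold torusMap; fun_prop

theorem torusIntegrable_of_continuousOn {n : ℕ} {f : (Fin n → ℂ) → ℂ} {R : Fin n → ℝ}
    (hR : ∀ i, 0 ≤ R i) (hf : ContinuousOn f {z | ∀ i, ‖z i‖ = R i}) :
    TorusIntegrable f 0 R := by
  have : Continuous fun θ => f (torusMap 0 R θ) :=
    hf.comp_continuous (continuous_torusMap 0 R) fun θ i => norm_torusMap_zero hR θ i
  exact this.continuousOn.integrableOn_compact isCompact_Icc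

/-- Radii in one coordinate may be changed within an annulus of holomorphy. -/
theorem torusIntegral_update_radius {n : ℕ} {f : (Fin n → ℂ) → ℂ} {R : Fin n → ℝ} {ρ r : ℝ}
    (hρ : 0 < ρ) (hρr : ρ ≤ r) (hR : ∀ i, R i ∈ Set.Icc ρ r)
    (hc : ContinuousOn f {z | ∀ i, ‖z i‖ ∈ Set.Icc ρ r})
    (hd : ∀ (i : Fin n) (z : Fin n → ℂ), (∀ j, ‖z j‖ ∈ Set.Icc ρ r) → ‖z i‖ ∈ Set.Ioo ρ r →
      DifferentiableAt ℂ (fun x => f (Function.update z i x)) (z i)) (i : Fin n)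
    (hi : R i = r) :
    torusIntegral f 0 R = torusIntegral f 0 (Function.update R i ρ) := by
  obtain _ | n := n
  · exact i.elim0
  have hR0 : ∀ i, 0 ≤ R i := fun i => hρ.le.trans (hR i).1
  have hR' : ∀ j, Function.update R i ρ j ∈ Set.Icc ρ r := by
    intro j
    rcases eq_or_ne j i with rfl | h
    · simp [hρr]
    · simpa [h] using hR j
  have hint : ∀ S : Fin (n + 1) → ℝ, (∀ j, S j ∈ Set.Icc ρ r) → TorusIntegrable f 0 S := by
    intro S hS
    refine torusIntegrable_of_continuousOn (fun j => hρ.le.trans (hS j).1) (hc.mono ?_)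
    intro z hz j
    rw [hz j]; exact hS j
  rw [torusIntegral_succAbove_inner (hint _ hR) i, torusIntegral_succAbove_inner (hint _ hR') i]
  have h1 : Function.update R i ρ ∘ i.succAbove = R ∘ i.succAbove := by
    ext j; simp
  rw [h1]
  unfold torusIntegral
  congr 1
  ext θ
  congr 1
  simp only [Pi.zero_apply, hi, Function.update_self]
  set y := torusMap ((0 : Fin (n + 1) → ℂ) ∘ i.succAbove) (R ∘ i.succAbove) θ with hy
  have hyn : ∀ j, ‖y j‖ = R (i.succAbove j) := fun j =>
    norm_torusMap_zero (R := R ∘ i.succAbove) (fun _ => hR0 _) θ j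
  have hmem : ∀ x : ℂ, ‖x‖ ∈ Set.Icc ρ r →
      ∀ j, ‖(i.insertNth x y : Fin (n + 1) → ℂ) j‖ ∈ Set.Icc ρ r := by
    intro x hx j
    refine Fin.succAboveCases i ?_ ?_ j
    · simpa using hx
    · intro j; simpa [hyn] using hR _
  refine Complex.circleIntegral_eq_of_differentiable_on_annulus_off_countable hρ hρr
    Set.countable_empty ?_ ?_
  · refine hc.comp (Continuous.continuousOn ?_) ?_
    · refine continuous_pi fun j => ?_
      refine Fin.succAboveCases i ?_ ?_ j
      · simpa using continuous_id'
      · intro j; simpa using continuous_const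
    · intro x hx
      refine hmem x ?_
      simp only [Set.mem_sdiff, Metric.mem_closedBall, dist_zero_right, Metric.mem_ball,
        not_lt] at hx
      exact ⟨hx.2, hx.1⟩
  · intro x hx
    simp only [Set.mem_sdiff, Metric.mem_closedBall, dist_zero_right, Metric.mem_ball,
      not_le, Set.mem_empty_iff_false, not_false_eq_true, and_true] at hx
    have := hd i (i.insertNth x y) (hmem x ⟨hx.2.le, hx.1.le⟩) (by simpa using ⟨hx.2, hx.1⟩)
    simpa using this

/-- A torus integral does not change when all radii shrink within a polyannulus of holomorphy. -/
theorem torusIntegral_shrink {n : ℕ} {f : (Fin n → ℂ) → ℂ} {ρ r : ℝ}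
    (hρ : 0 < ρ) (hρr : ρ ≤ r)
    (hc : ContinuousOn f {z | ∀ i, ‖z i‖ ∈ Set.Icc ρ r})
    (hd : ∀ (i : Fin n) (z : Fin n → ℂ), (∀ j, ‖z j‖ ∈ Set.Icc ρ r) → ‖z i‖ ∈ Set.Ioo ρ r →
      DifferentiableAt ℂ (fun x => f (Function.update z i x)) (z i)) :
    torusIntegral f 0 (fun _ => r) = torusIntegral f 0 (fun _ => ρ) := by
  -- The radii are shrunk one coordinate at a time; `s` records the coordinates already moved.
  have key : ∀ s : Finset (Fin n),
      torusIntegral f 0 (fun _ => r) = torusIntegral f 0 (fun i => if i ∈ s then ρ else r) := by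
    intro s
    induction s using Finset.induction_on with
    | empty => simp
    | insert i s his ih =>
      rw [ih, torusIntegral_update_radius hρ hρr _ hc hd i (by simp [his])]
      · congr 1
        ext j
        rcases eq_or_ne j i with rfl | h
        · simp
        · simp [h]
      · intro j
        split_ifs <;> simp [hρr]
  simpa using key Finset.univ

theorem torusIntegral_scale {n : ℕ} (f : (Fin n → ℂ) → ℂ) (ρ : ℝ) :
    torusIntegral f 0 (fun _ => ρ) =
      (ρ : ℂ) ^ n * torusIntegral (fun w => f (fun i => ρ * w i)) 0 (fun _ => 1) := by
  rw [← torusIntegral_const_mul]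
  unfold torusIntegral
  congr 1
  ext θ
  have : torusMap (0 : Fin n → ℂ) (fun _ => ρ) θ =
      fun i => (ρ : ℂ) * torusMap (0 : Fin n → ℂ) (fun _ => 1) θ i := by
    ext i; simp [torusMap]
  rw [this]
  simp only [smul_eq_mul, mul_assoc, Finset.prod_mul_distrib, Finset.prod_const, Finset.card_univ,
    Fintype.card_fin, Complex.ofReal_one, one_mul]
  ring

theorem torusIntegral_prod {n : ℕ} (g : Fin n → ℂ → ℂ) (R : ℝ) :
    torusIntegral (fun z => ∏ i, g i (z i)) 0 (fun _ => R) =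
      ∏ i, circleIntegral (g i) 0 R := by
  unfold torusIntegral
  simp only [circleIntegral_def_Icc]
  rw [← MeasureTheory.integral_fintype_prod_eq_prod, ← MeasureTheory.Measure.restrict_pi_pi,
    ← MeasureTheory.volume_pi, Set.pi_univ_Icc]
  refine MeasureTheory.setIntegral_congr_fun measurableSet_Icc fun θ _ => ?_
  simp [torusMap, Finset.prod_mul_distrib, deriv_circleMap, circleMap]

theorem torusIntegral_finset_sum {n : ℕ} {ι : Type*} (s : Finset ι) (f : ι → (Fin n → ℂ) → ℂ)
    (c : Fin n → ℂ) (R : Fin n → ℝ) (hf : ∀ i ∈ s, TorusIntegrable (f i) c R) :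
    torusIntegral (fun z => ∑ i ∈ s, f i z) c R = ∑ i ∈ s, torusIntegral (f i) c R := by
  unfold torusIntegral
  simp only [Finset.smul_sum]
  exact MeasureTheory.integral_finsetSum _ fun i hi => (hf i hi).function_integrable

/-- The algebraic identity behind Andréief's integral formula. -/
theorem sum_sign_mul_sign_prod {n : ℕ} (m : Fin n → Fin n → ℂ) :
    ∑ σ : Equiv.Perm (Fin n), ∑ τ : Equiv.Perm (Fin n),
      ((Equiv.Perm.sign σ : ℤ) : ℂ) * ((Equiv.Perm.sign τ : ℤ) : ℂ) * ∏ i, m (σ i) (τ i) =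
      (n ! : ℂ) * (Matrix.of m).det := by
  have h : ∀ τ : Equiv.Perm (Fin n), ∑ σ : Equiv.Perm (Fin n),
      ((Equiv.Perm.sign σ : ℤ) : ℂ) * ((Equiv.Perm.sign τ : ℤ) : ℂ) * ∏ i, m (σ i) (τ i) =
      (Matrix.of m).det := by
    intro τ
    -- Substituting $\sigma\mapsto\sigma\tau$ and reindexing the product by $\tau$ leaves the factor
    -- $\operatorname{sgn}(\tau)^2=1$, so every $\tau$ contributes the same determinant.
    rw [Matrix.det_apply', ← Equiv.sum_comp (Equiv.mulRight τ)]
    refine Finset.sum_congr rfl fun σ _ => ?_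
    rw [← Equiv.prod_comp τ (fun i => (Matrix.of m) (σ i) i)]
    simp only [Equiv.coe_mulRight, Equiv.Perm.sign_mul, Equiv.Perm.mul_apply, Matrix.of_apply]
    have : ((Equiv.Perm.sign τ : ℤ) : ℂ) * ((Equiv.Perm.sign τ : ℤ) : ℂ) = 1 := by
      rcases Int.units_eq_one_or (Equiv.Perm.sign τ) with h | h <;> simp [h]
    push_cast
    linear_combination (((Equiv.Perm.sign σ : ℤ) : ℂ) * ∏ i, m (σ (τ i)) (τ i)) * this
  rw [Finset.sum_comm, Finset.sum_congr rfl fun τ _ => h τ]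
  simp [Fintype.card_perm]

/-- Andréief's formula on a torus. -/
theorem torusIntegral_det_mul_det {n : ℕ} (u v : Fin n → ℂ → ℂ) (g : ℂ → ℂ) {R : ℝ}
    (hR : 0 ≤ R) (hu : ∀ j, ContinuousOn (u j) (Metric.sphere 0 R))
    (hv : ∀ j, ContinuousOn (v j) (Metric.sphere 0 R)) (hg : ContinuousOn g (Metric.sphere 0 R)) :
    torusIntegral (fun z => (Matrix.of fun j i => u j (z i)).det *
        (Matrix.of fun j i => v j (z i)).det * ∏ i, g (z i)) 0 (fun _ => R) =
      (n ! : ℂ) *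
        (Matrix.of fun j l => circleIntegral (fun w => u j w * v l w * g w) 0 R).det := by
  rw [← sum_sign_mul_sign_prod]
  have h : (fun z : Fin n → ℂ => (Matrix.of fun j i => u j (z i)).det *
        (Matrix.of fun j i => v j (z i)).det * ∏ i, g (z i)) =
      fun z => ∑ σ : Equiv.Perm (Fin n), ∑ τ : Equiv.Perm (Fin n),
        ((Equiv.Perm.sign σ : ℤ) : ℂ) * ((Equiv.Perm.sign τ : ℤ) : ℂ) *
          ∏ i, (u (σ i) (z i) * v (τ i) (z i) * g (z i)) := by
    ext z
    rw [Matrix.det_apply', Matrix.det_apply', Finset.sum_mul_sum, Finset.sum_mul]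
    refine Finset.sum_congr rfl fun σ _ => ?_
    rw [Finset.sum_mul]
    refine Finset.sum_congr rfl fun τ _ => ?_
    simp only [Matrix.of_apply, Finset.prod_mul_distrib]
    ring
  have hint : ∀ σ τ : Equiv.Perm (Fin n), TorusIntegrable (fun z : Fin n → ℂ =>
      ((Equiv.Perm.sign σ : ℤ) : ℂ) * ((Equiv.Perm.sign τ : ℤ) : ℂ) *
          ∏ i, (u (σ i) (z i) * v (τ i) (z i) * g (z i))) 0 (fun _ => R) := by
    intro σ τ
    refine torusIntegrable_of_continuousOn (fun _ => hR) (continuousOn_const.mul ?_)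
    refine continuousOn_finsetProd _ fun i _ => ?_
    have hm : Set.MapsTo (fun z : Fin n → ℂ => z i) {z | ∀ i, ‖z i‖ = R}
        (Metric.sphere 0 R) := fun z hz => by simpa using hz i
    have hp : ContinuousOn (fun z : Fin n → ℂ => z i) {z | ∀ i, ‖z i‖ = R} :=
      (continuous_apply i).continuousOn
    exact (((hu _).comp hp hm).mul ((hv _).comp hp hm)).mul (hg.comp hp hm)
  rw [h, torusIntegral_finset_sum]
  · refine Finset.sum_congr rfl fun σ _ => ?_
    rw [torusIntegral_finset_sum _ _ _ _ fun τ _ => hint σ τ]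
    refine Finset.sum_congr rfl fun τ _ => ?_
    rw [torusIntegral_const_mul,
      torusIntegral_prod (fun i w => u (σ i) w * v (τ i) w * g w)]
  · intro σ _
    have := fun τ => hint σ τ
    exact MeasureTheory.integrable_finsetSum _ fun τ _ => this τ

/-- Dilating a factor continuous at the origin freezes it at its central value. -/
theorem tendsto_torusIntegral_dilate {n : ℕ} {H K : (Fin n → ℂ) → ℂ} {r : ℝ} (hr : 0 < r)
    (hH : ContinuousOn H {z | ∀ i, ‖z i‖ ≤ r}) (hK : ContinuousOn K {z | ∀ i, ‖z i‖ = 1})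
    {ι : Type*} {l : Filter ι} {ρ : ι → ℝ} (hρ : Tendsto ρ l (nhds 0)) :
    Tendsto (fun t => torusIntegral (fun w => H (fun i => ρ t * w i) * K w) 0 (fun _ => 1)) l
      (nhds (H 0 * torusIntegral K 0 (fun _ => 1))) := by
  obtain ⟨B, hB⟩ : ∃ B, ∀ z : Fin n → ℂ, (∀ i, ‖z i‖ = 1) → ‖K z‖ ≤ B := by
    have hcomp : IsCompact {z : Fin n → ℂ | ∀ i, ‖z i‖ = 1} := by
      have : {z : Fin n → ℂ | ∀ i, ‖z i‖ = 1} =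
          Set.univ.pi fun _ => Metric.sphere (0 : ℂ) 1 := by
        ext z; simp
      rw [this]
      exact isCompact_univ_pi fun _ => isCompact_sphere 0 1
    exact hcomp.exists_bound_of_continuousOn hK
  rw [Metric.tendsto_nhds]
  intro ε hε
  have hH0 : ContinuousAt H 0 := by
    refine hH.continuousAt ?_
    refine Filter.mem_of_superset (Metric.closedBall_mem_nhds 0 hr) fun z hz i => ?_
    exact (norm_le_pi_norm z i).trans (by simpa using hz)
  -- The torus has measure $(2\pi)^n$ and $|K|\le|B|$ on it; the extra $1$ makes the final
  -- inequality strict and allows $B=0$.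
  set δ := ε / ((2 * Real.pi) ^ n * (|B| + 1)) with hδ
  have hδ0 : 0 < δ := by positivity
  obtain ⟨η, hη, hHη⟩ := Metric.continuousAt_iff.1 hH0 δ hδ0
  have h1 : ∀ᶠ t in l, |ρ t| < η := by
    simpa [Real.dist_eq] using Metric.tendsto_nhds.1 hρ η hη
  have h2 : ∀ᶠ t in l, |ρ t| < r := by
    simpa [Real.dist_eq] using Metric.tendsto_nhds.1 hρ r hr
  filter_upwards [h1, h2] with t ht1 ht2
  rw [dist_eq_norm, ← torusIntegral_const_mul, ← torusIntegral_sub]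
  · have hb : ∀ θ, ‖H (fun i => ρ t * torusMap (0 : Fin n → ℂ) (fun _ => 1) θ i) *
        K (torusMap 0 (fun _ => 1) θ) - H 0 * K (torusMap 0 (fun _ => 1) θ)‖ ≤ δ * |B| := by
      intro θ
      have hn := norm_torusMap_zero (R := fun _ : Fin n => 1) (fun _ => zero_le_one) θ
      rw [← sub_mul, norm_mul]
      refine mul_le_mul ?_ ((hB _ hn).trans (le_abs_self B)) (norm_nonneg _) hδ0.le
      rw [← dist_eq_norm]
      refine (hHη ?_).le
      rw [dist_zero_right, pi_norm_lt_iff hη]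
      intro i
      simpa [hn] using ht1
    refine (norm_torusIntegral_le_of_norm_le_const hb).trans_lt ?_
    simp only [abs_one, Finset.prod_const_one, mul_one]
    calc (2 * Real.pi) ^ n * (δ * |B|) < (2 * Real.pi) ^ n * (δ * (|B| + 1)) := by
          gcongr; linarith
      _ = ε := by rw [hδ]; field_simp
  · refine torusIntegrable_of_continuousOn (fun _ => zero_le_one) (ContinuousOn.mul ?_ hK)
    refine hH.comp (by fun_prop) fun z hz i => ?_
    simpa [hz i] using ht2.le
  · exact torusIntegrable_of_continuousOn (fun _ => zero_le_one) (continuousOn_const.mul hK)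

/-! ### The model residue and its determinant. -/

/-- For $a\le m$ Cauchy's formula yields the Taylor coefficient $1/(m-a)!$ of the exponential. The
quotient by $m!$ is a uniform way to write it: for $a>m$ the integrand is entire on the disc and the
falling factorial vanishes too. Both cases occur below, with $m=2k-1$ and $a=j+2l$. -/
theorem circleIntegral_pow_mul_exp_div_pow (m a : ℕ) :
    circleIntegral (fun w => w ^ a * (Complex.exp w / w ^ (m + 1))) 0 1 =
      2 * Real.pi * Complex.I * ((m.descFactorial a : ℂ) / (m ! : ℂ)) := by
  rcases le_or_gt a m with h | h
  · have hc := DifferentiableOn.circleIntegral_one_div_sub_center_pow_smul (c := 0) (R := 1)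
      one_pos (m - a) (f := Complex.exp) Complex.differentiable_exp.differentiableOn
    have hm : ((m - a)! : ℂ) * (m.descFactorial a : ℂ) = (m ! : ℂ) := by
      exact_mod_cast Nat.factorial_mul_descFactorial h
    have h0 : ((m - a)! : ℂ) ≠ 0 := by exact_mod_cast Nat.factorial_ne_zero _
    have h1 : (m ! : ℂ) ≠ 0 := by exact_mod_cast Nat.factorial_ne_zero _
    have h2 : (m.descFactorial a : ℂ) / (m ! : ℂ) = 1 / ((m - a)! : ℂ) := by
      rw [← hm] at h1 ⊢
      have := right_ne_zero_of_mul h1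
      field_simp
    rw [h2, mul_one_div]
    rw [iteratedDeriv_eq_iterate, Complex.iter_deriv_exp, Complex.exp_zero, smul_eq_mul,
      mul_one] at hc
    rw [← hc]
    refine circleIntegral.integral_congr zero_le_one fun w hw => ?_
    have hw0 : w ≠ 0 := by
      rintro rfl; simp at hw
    obtain ⟨d, rfl⟩ := Nat.exists_eq_add_of_le h
    simp only [sub_zero, smul_eq_mul, Nat.add_sub_cancel_left]
    field_simp
    ring
  · rw [Nat.descFactorial_of_lt h]
    simp only [Nat.cast_zero, zero_div, mul_zero]
    have : circleIntegral (fun w => w ^ a * (Complex.exp w / w ^ (m + 1))) 0 1 =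
        circleIntegral (fun w => w ^ (a - (m + 1)) * Complex.exp w) 0 1 := by
      refine circleIntegral.integral_congr zero_le_one fun w hw => ?_
      have hw0 : w ≠ 0 := by
        rintro rfl; simp at hw
      obtain ⟨d, rfl⟩ := Nat.exists_eq_add_of_le (Nat.succ_le_of_lt h)
      simp only [Nat.succ_eq_add_one, Nat.add_sub_cancel_left]
      field_simp
      ring
    rw [this]
    refine Complex.circleIntegral_eq_zero_of_differentiable_on_off_countable zero_le_one
      Set.countable_empty (by fun_prop) fun z _ => by fun_prop

theorem prod_prod_Ioi_const (k : ℕ) (c : ℂ) :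
    ∏ i : Fin k, ∏ _j ∈ Finset.Ioi i, c = c ^ (k * (k - 1) / 2) := by
  simp only [Finset.prod_const, Fin.card_Ioi, Finset.prod_pow_eq_pow_sum]
  congr 1
  rw [Fin.sum_univ_eq_sum_range (fun i => k - 1 - i) k, Finset.sum_range_reflect (fun i => i),
    Finset.sum_range_id]

/-- Triangular numbers, in the form needed for counting pairs. -/
theorem triangle_succ (k : ℕ) : k * (k + 1) / 2 = k * (k - 1) / 2 + k := by
  obtain _ | n := k
  · rfl
  · have : (n + 1) * (n + 1 + 1) = (n + 1) * n + (n + 1) * 2 := by ring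
    rw [this, Nat.add_mul_div_right _ _ two_pos]; simp

theorem mul_self_eq_triangle (k : ℕ) : k * k = 2 * (k * (k - 1) / 2) + k := by
  rw [Nat.mul_div_cancel' (Nat.even_mul_pred_self k).two_dvd]
  obtain _ | n := k
  · rfl
  · simp; ring

theorem two_pow_triangle (k : ℕ) :
    (2 : ℂ) ^ (k * (k - 1) / 2) * 2 ^ k = 2 ^ (k * (k + 1) / 2) := by
  rw [← pow_add, triangle_succ]

theorem det_vandermonde_id (k : ℕ) :
    (Matrix.vandermonde fun i : Fin k => ((i : ℕ) : ℂ)).det =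
      ∏ j ∈ Finset.range k, (j ! : ℂ) := by
  obtain _ | n := k
  · simp
  · rw [Matrix.det_vandermonde_id_eq_superFactorial, ← Nat.prod_range_succ_factorial]
    push_cast
    rfl

/-- The determinant of the Taylor coefficients `1 / (2k - 1 - 2l - j)!`. -/
theorem det_descFactorial (k : ℕ) (hk : 1 ≤ k) :
    (-1) ^ (k * (k - 1) / 2) * (Matrix.of fun j l : Fin k =>
      ((2 * k - 1).descFactorial (j + 2 * l : ℕ) : ℂ) / ((2 * k - 1)! : ℂ)).det =
      2 ^ (k * (k + 1) / 2) * ∏ j ∈ Finset.Icc 1 k, ((j ! : ℂ) / ((2 * j)! : ℂ)) := by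
  -- A falling factorial of length $j+2l$ splits into one of length $2l$ and one of length $j$
  -- starting at $2k-1-2l$. So column $l$ has the scalar $1/(2k-1-2l)!$, and what remains evaluates
  -- monic polynomials of degree $j$ at the nodes $2k-1-2l$: a Vandermonde determinant up to row
  -- operations.
  have hentry : (Matrix.of fun j l : Fin k =>
      ((2 * k - 1).descFactorial (j + 2 * l : ℕ) : ℂ) / ((2 * k - 1)! : ℂ)) =
      Matrix.of fun j l : Fin k => (1 / ((2 * k - 1 - 2 * l : ℕ)! : ℂ)) *
        (Matrix.of fun i j : Fin k =>
          (descPochhammer ℂ j).eval (((2 * k - 1 - 2 * i : ℕ)) : ℂ)).transpose j l := by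
    ext j l
    simp only [Matrix.of_apply, Matrix.transpose_apply, descPochhammer_eval_eq_descFactorial]
    have hl : 2 * (l : ℕ) ≤ 2 * k - 1 := by omega
    have h1 := Nat.factorial_mul_descFactorial hl
    have h2 := Nat.descFactorial_mul_descFactorial (n := 2 * k - 1)
      (show 2 * (l : ℕ) ≤ j + 2 * l by omega)
    rw [Nat.add_sub_cancel] at h2
    have h0 : ((2 * k - 1)! : ℂ) ≠ 0 := by exact_mod_cast Nat.factorial_ne_zero _
    have h3 : ((2 * k - 1 - 2 * l : ℕ)! : ℂ) ≠ 0 := by exact_mod_cast Nat.factorial_ne_zero _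
    rw [div_eq_iff h0, ← h2, ← h1]
    push_cast
    field_simp
  rw [hentry, Matrix.det_mul_row, Matrix.det_transpose,
    ← Matrix.det_eval_matrixOfPolynomials_eq_det_vandermonde
      (fun i : Fin k => (((2 * k - 1 - 2 * i : ℕ)) : ℂ)) (fun j => descPochhammer ℂ j)
      (fun i => descPochhammer_natDegree ℂ i) (fun i => monic_descPochhammer ℂ i)]
  have hx : ∀ i : Fin k, ((2 * k - 1 - 2 * i : ℕ) : ℂ) = 2 * k - 1 - 2 * i := by
    intro i
    rw [Nat.cast_sub (by omega), Nat.cast_sub (by omega)]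
    push_cast
    ring
  -- Differences of the nodes are $-2$ times those of $0,\dots,k-1$; the resulting sign cancels the
  -- one in the statement.
  have hv : (Matrix.vandermonde fun i : Fin k => (((2 * k - 1 - 2 * i : ℕ)) : ℂ)).det =
      (-2) ^ (k * (k - 1) / 2) * ∏ j ∈ Finset.range k, (j ! : ℂ) := by
    rw [← det_vandermonde_id, Matrix.det_vandermonde, Matrix.det_vandermonde,
      ← prod_prod_Ioi_const, ← Finset.prod_mul_distrib]
    refine Finset.prod_congr rfl fun i _ => ?_
    rw [← Finset.prod_mul_distrib]
    refine Finset.prod_congr rfl fun j _ => ?_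
    rw [hx i, hx j]
    ring
  have hr : ∏ i : Fin k, (1 / ((2 * k - 1 - 2 * i : ℕ)! : ℂ)) =
      ∏ j ∈ Finset.range k, (1 / ((2 * j + 1)! : ℂ)) := by
    rw [Fin.prod_univ_eq_prod_range (fun i => 1 / ((2 * k - 1 - 2 * i : ℕ)! : ℂ)) k,
      ← Finset.prod_range_reflect]
    refine Finset.prod_congr rfl fun j hj => ?_
    rw [Finset.mem_range] at hj
    congr 4
    omega
  -- From $(2j+2)!=2(j+1)(2j+1)!$; the $k$ factors $\frac12$ account for the passage from
  -- $2^{k(k-1)/2}$ to $2^{k(k+1)/2}$.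
  have hI : ∏ j ∈ Finset.Icc 1 k, ((j ! : ℂ) / ((2 * j)! : ℂ)) =
      ∏ j ∈ Finset.range k, (2⁻¹ * (1 / ((2 * j + 1)! : ℂ) * (j ! : ℂ))) := by
    rw [← Finset.Ico_add_one_right_eq_Icc, Finset.prod_Ico_eq_prod_range]
    refine Finset.prod_congr (by simp) fun j _ => ?_
    have e : 2 * (1 + j) = (2 * j + 1) + 1 := by ring
    rw [e, add_comm 1 j, Nat.factorial_succ (2 * j + 1), Nat.factorial_succ j]
    have h3 : ((2 * j + 1)! : ℂ) ≠ 0 := by exact_mod_cast Nat.factorial_ne_zero _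
    have h4 : (j : ℂ) + 1 ≠ 0 := by exact_mod_cast Nat.succ_ne_zero j
    have h5 : (2 * (j : ℂ) + 1 + 1) = 2 * (j + 1) := by ring
    push_cast
    rw [h5]
    field_simp
  rw [hv, hr, hI, ← two_pow_triangle, Finset.prod_mul_distrib, Finset.prod_mul_distrib,
    Finset.prod_const, Finset.card_range, show (-2 : ℂ) = -1 * 2 by norm_num, mul_pow]
  have hs : ((-1 : ℂ) ^ (k * (k - 1) / 2)) * (-1) ^ (k * (k - 1) / 2) = 1 := by
    rw [← mul_pow]; norm_num
  have h2 : (2 : ℂ) ^ k * 2⁻¹ ^ k = 1 := by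
    rw [← mul_pow]; norm_num
  set P1 := ∏ j ∈ Finset.range k, (1 / ((2 * j + 1)! : ℂ))
  set P2 := ∏ j ∈ Finset.range k, (j ! : ℂ)
  linear_combination (2 ^ (k * (k - 1) / 2) * P1 * P2) * (hs - h2)

/-- The model residue computing the leading coefficient. -/
theorem torusIntegral_vand_mul_vand_sq (k : ℕ) (hk : 1 ≤ k) :
    (-1) ^ (k * (k - 1) / 2) / (k ! : ℂ) * (1 / (2 * (Real.pi : ℂ) * Complex.I) ^ k) *
      torusIntegral (fun w : Fin k → ℂ => vand w * vand (fun j => w j ^ 2) *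
        ∏ j, (Complex.exp (w j) / w j ^ (2 * k))) 0 (fun _ => 1) =
      2 ^ (k * (k + 1) / 2) * ∏ j ∈ Finset.Icc 1 k, ((j ! : ℂ) / ((2 * j)! : ℂ)) := by
  have hv : ∀ w : Fin k → ℂ, vand w = (Matrix.of fun j i : Fin k => w i ^ (j : ℕ)).det := by
    intro w
    rw [vand, ← Matrix.det_vandermonde, ← Matrix.det_transpose]
    rfl
  have hne : ∀ w ∈ Metric.sphere (0 : ℂ) 1, w ^ (2 * k) ≠ 0 := by
    rintro w hw
    refine pow_ne_zero _ ?_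
    rintro rfl; simp at hw
  -- Both factors are Vandermonde determinants, one in $w$ and one in $w^2$, so Andréief applies
  -- with $u_j=w^j$, $v_l=w^{2l}$ and weight $e^w/w^{2k}$.
  have h := torusIntegral_det_mul_det (fun (j : Fin k) w => w ^ (j : ℕ))
    (fun (j : Fin k) w => (w ^ 2) ^ (j : ℕ)) (fun w => Complex.exp w / w ^ (2 * k)) zero_le_one
    (fun j => by fun_prop) (fun j => by fun_prop)
    (ContinuousOn.div (by fun_prop) (by fun_prop) hne)
  simp only [hv]
  rw [h, ← det_descFactorial k hk]
  have hm : (Matrix.of fun j l : Fin k => circleIntegral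
      (fun w => w ^ (j : ℕ) * (w ^ 2) ^ (l : ℕ) * (Complex.exp w / w ^ (2 * k))) 0 1) =
      (2 * Real.pi * Complex.I) • (Matrix.of fun j l : Fin k =>
      ((2 * k - 1).descFactorial (j + 2 * l : ℕ) : ℂ) / ((2 * k - 1)! : ℂ)) := by
    ext j l
    simp only [Matrix.of_apply, Matrix.smul_apply, smul_eq_mul]
    rw [← circleIntegral_pow_mul_exp_div_pow, Nat.sub_add_cancel (by omega)]
    simp only [← pow_mul, ← pow_add]
  rw [hm, Matrix.det_smul, Fintype.card_fin]
  have h0 : (k ! : ℂ) ≠ 0 := by exact_mod_cast Nat.factorial_ne_zero _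
  have h1 := Complex.two_pi_I_ne_zero
  field_simp

/-! ### Cancellation of the second-order terms in the local factors. -/

/-- `∏_{i ≤ j} (1 - y_i y_j)`. -/
noncomputable def pairProd {k : ℕ} (y : Fin k → ℂ) : ℂ :=
  ∏ i : Fin k, ∏ j ∈ Finset.Ici i, (1 - y i * y j)

/-- The part of `∏ (1 - y_j)⁻¹` of even degree. -/
noncomputable def evenPart {k : ℕ} (y : Fin k → ℂ) : ℂ :=
  1 / 2 * ((∏ j, (1 - y j)⁻¹) + ∏ j, (1 + y j)⁻¹)

/-- The part of `∏ (1 - y_j)⁻¹` of odd degree. -/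
noncomputable def oddPart {k : ℕ} (y : Fin k → ℂ) : ℂ :=
  1 / 2 * ((∏ j, (1 - y j)⁻¹) - ∏ j, (1 + y j)⁻¹)

theorem pairProd_succ {k : ℕ} (y : Fin (k + 1) → ℂ) :
    pairProd y = (1 - y 0 ^ 2) * (∏ j : Fin k, (1 - y 0 * y j.succ)) *
      pairProd (fun j => y j.succ) := by
  unfold pairProd
  rw [Fin.prod_univ_succ, ← bot_eq_zero, Finset.Ici_bot, Fin.prod_univ_succ]
  simp only [bot_eq_zero, Fin.prod_Ici_succ]
  ring

/-- Because $(1-y_0)^{-1}=(1+y_0)/(1-y_0^2)$, splitting off a variable mixes the two parities; the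
denominator is then cancelled by the diagonal factor of `pairProd`. -/
theorem evenPart_succ {k : ℕ} (y : Fin (k + 1) → ℂ) (h : 1 - y 0 ^ 2 ≠ 0) :
    (1 - y 0 ^ 2) * evenPart y =
      evenPart (fun j => y j.succ) + y 0 * oddPart (fun j => y j.succ) := by
  have h1 : (1 - y 0) * (1 + y 0) ≠ 0 := by convert h using 1; ring
  have h2 := left_ne_zero_of_mul h1
  have h3 := right_ne_zero_of_mul h1
  unfold evenPart oddPart
  rw [Fin.prod_univ_succ, Fin.prod_univ_succ]
  field_simp
  ring

theorem oddPart_succ {k : ℕ} (y : Fin (k + 1) → ℂ) (h : 1 - y 0 ^ 2 ≠ 0) :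
    (1 - y 0 ^ 2) * oddPart y =
      oddPart (fun j => y j.succ) + y 0 * evenPart (fun j => y j.succ) := by
  have h1 : (1 - y 0) * (1 + y 0) ≠ 0 := by convert h using 1; ring
  have h2 := left_ne_zero_of_mul h1
  have h3 := right_ne_zero_of_mul h1
  unfold evenPart oddPart
  rw [Fin.prod_univ_succ, Fin.prod_univ_succ]
  field_simp
  ring

section BigO

variable {α : Type*} {l : Filter α} {ρ : α → ℝ}

theorem isBigO_pow_of_le (hρ : ρ =O[l] (fun _ => (1 : ℝ))) {m n : ℕ} (h : n ≤ m) :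
    (fun t => ρ t ^ m) =O[l] fun t => ρ t ^ n := by
  obtain ⟨d, rfl⟩ := Nat.exists_eq_add_of_le h
  simpa [pow_add] using (isBigO_refl (fun t => ρ t ^ n) l).mul (hρ.pow d)

theorem prod_one_sub_isBigO (hρ : ρ =O[l] (fun _ => (1 : ℝ))) {ι : Type*} (s : Finset ι)
    (c : ι → α → ℂ) (hc : ∀ i ∈ s, c i =O[l] fun t => ρ t ^ 2) :
    (fun t => ∏ i ∈ s, (1 - c i t) - (1 - ∑ i ∈ s, c i t)) =O[l] fun t => ρ t ^ 4 := by
  induction s using Finset.induction_on with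
  | empty => simpa using isBigO_zero _ _
  | insert a s ha ih =>
    have hs : ∀ i ∈ s, c i =O[l] fun t => ρ t ^ 2 := fun i hi => hc i (by simp [hi])
    have ha' := hc a (by simp)
    have h1 := ih hs
    have h2 : (fun t => ∑ i ∈ s, c i t) =O[l] fun t => ρ t ^ 2 := IsBigO.fun_sum hs
    have h3 : (fun t => (1 : ℂ) - c a t) =O[l] fun _ => (1 : ℝ) :=
      (isBigO_const_const _ one_ne_zero _).sub
        (ha'.trans (by simpa using isBigO_pow_of_le hρ (Nat.zero_le 2)))
    have h4 := h3.mul h1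
    have h5 := ha'.mul h2
    simp only [one_mul, ← pow_add] at h4 h5
    refine (h4.add h5).congr_left fun t => ?_
    rw [Finset.prod_insert ha, Finset.sum_insert ha]
    ring

/-- After multiplication by `∏_{i ≤ j} (1 - y_i y_j)`, the even part of `∏ (1 - y_j)⁻¹` is
`1` up to terms of order four. -/
theorem pairProd_isBigO (hρ : ρ =O[l] (fun _ => (1 : ℝ))) (k : ℕ) (y : α → Fin k → ℂ)
    (hy : ∀ j, (fun t => y t j) =O[l] ρ) (hne : ∀ t j, 1 - y t j ^ 2 ≠ 0) :
    (fun t => pairProd (y t) - 1) =O[l] (fun t => ρ t ^ 2) ∧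
    (fun t => pairProd (y t) * evenPart (y t) - 1) =O[l] (fun t => ρ t ^ 4) ∧
    (fun t => pairProd (y t) * oddPart (y t) - ∑ j, y t j) =O[l] (fun t => ρ t ^ 3) := by
  -- The recursions for the even and odd parts are coupled, so the estimates must be carried
  -- together.
  induction k with
  | zero =>
    simp [pairProd, evenPart, oddPart]
    norm_num
    exact ⟨isBigO_zero _ _, isBigO_zero _ _, isBigO_zero _ _⟩
  | succ k ih =>
    obtain ⟨h1, h2, h3⟩ := ih (fun t (j : Fin k) => y t j.succ) (fun j => hy j.succ)
      fun t (j : Fin k) => hne t j.succ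
    have y0 := hy 0
    have yy : ∀ j : Fin k, (fun t => y t 0 * y t j.succ) =O[l] fun t => ρ t ^ 2 := fun j => by
      simpa [pow_two] using y0.mul (hy j.succ)
    have hS : (fun t => ∑ j : Fin k, y t j.succ) =O[l] ρ := IsBigO.fun_sum fun j _ => hy j.succ
    have hp := prod_one_sub_isBigO hρ Finset.univ (fun (j : Fin k) t => y t 0 * y t j.succ)
      fun j _ => yy j
    have hp2 : (fun t => ∏ j : Fin k, (1 - y t 0 * y t j.succ) - 1) =O[l] fun t => ρ t ^ 2 := by
      have hs : (fun t => ∑ j : Fin k, y t 0 * y t j.succ) =O[l] fun t => ρ t ^ 2 :=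
        IsBigO.fun_sum fun j _ => yy j
      refine ((hp.trans (isBigO_pow_of_le hρ (by norm_num))).sub hs).congr_left fun t => ?_
      ring
    have one_of : ∀ {f : α → ℂ} {n : ℕ}, f =O[l] (fun t => ρ t ^ n) →
        f =O[l] fun _ => (1 : ℝ) := fun h => h.trans (by
          simpa using isBigO_pow_of_le hρ (Nat.zero_le _))
    have hp1 : (fun t => ∏ j : Fin k, (1 - y t 0 * y t j.succ)) =O[l] fun _ => (1 : ℝ) :=
      ((one_of hp2).add (isBigO_const_const (1 : ℂ) one_ne_zero _)).congr_left fun t => by ring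
    refine ⟨?_, ?_, ?_⟩
    · have a1 : (fun t => 1 - y t 0 ^ 2 - 1) =O[l] fun t => ρ t ^ 2 :=
        (y0.pow 2).neg_left.congr_left fun t => by ring
      have a2 : (fun t => 1 - y t 0 ^ 2) =O[l] fun _ => (1 : ℝ) :=
        ((one_of a1).add (isBigO_const_const (1 : ℂ) one_ne_zero _)).congr_left fun t => by ring
      have a3 := (a2.mul hp1).mul h1
      have a4 := a2.mul hp2
      simp only [one_mul] at a3 a4
      refine ((a3.add a4).add a1).congr_left fun t => ?_
      rw [pairProd_succ]
      ring
    -- With $S$ the sum of the remaining variables, the product is $(1-y_0S)(1+y_0S)$ up to order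
    -- four: the second-order terms from the pair product and from the odd part cancel.
    · have b1 := hp1.mul (h2.add (by simpa [← pow_succ'] using y0.mul h3))
      have b3 : (fun t => y t 0 * ∑ j : Fin k, y t j.succ) =O[l] fun t => ρ t ^ 2 := by
        simpa [pow_two] using y0.mul hS
      have b4 : (fun t => (y t 0 * ∑ j : Fin k, y t j.succ) ^ 2) =O[l] fun t => ρ t ^ 4 := by
        simpa [← pow_mul] using b3.pow 2
      have b5 := hp.mul ((isBigO_const_const (1 : ℂ) (one_ne_zero : (1 : ℝ) ≠ 0) l).add (one_of b3))
      simp only [one_mul, mul_one] at b1 b5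
      refine ((b1.add b5).sub b4).congr_left fun t => ?_
      have e := evenPart_succ (y t) (hne t 0)
      rw [pairProd_succ, ← Finset.mul_sum]
      linear_combination (-(∏ j : Fin k, (1 - y t 0 * y t j.succ)) *
        pairProd (fun j => y t j.succ)) * e
    · have c0 := isBigO_pow_of_le hρ (show 3 ≤ 5 by norm_num)
      have c1 := hp1.mul (h3.add ((y0.mul h2).trans (by simpa [← pow_succ'] using c0)))
      have c2 := hp2.mul (y0.add hS)
      simp only [one_mul, ← pow_succ] at c1 c2
      refine (c1.add c2).congr_left fun t => ?_
      have e := oddPart_succ (y t) (hne t 0)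
      rw [pairProd_succ, Fin.sum_univ_succ]
      linear_combination (-(∏ j : Fin k, (1 - y t 0 * y t j.succ)) *
        pairProd (fun j => y t j.succ)) * e

end BigO

/-! ### Counting polynomials, and sums over primes. -/

variable {F : Type*} [Field F] [Fintype F]

theorem two_le_q : 2 ≤ q F := Fintype.one_lt_card

theorem finite_degree_lt (n : ℕ) : {p : F[X] | p.degree < n}.Finite := by
  have : Finite (degreeLT F n) := Finite.of_equiv _ (degreeLTEquiv F n).toEquiv.symm
  refine (Set.toFinite (degreeLT F n : Set F[X])).subset fun p hp => ?_
  exact mem_degreeLT.2 hp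

theorem ncard_degree_lt (n : ℕ) : {p : F[X] | p.degree < n}.ncard = q F ^ n := by
  have h : {p : F[X] | p.degree < n} = (degreeLT F n : Set F[X]) := by
    ext p; exact mem_degreeLT.symm
  rw [h, ← Nat.card_coe_set_eq]
  exact (Nat.card_congr (degreeLTEquiv F n).toEquiv).trans (by simp [q])

theorem card_monic_natDegree (n : ℕ) :
    Nat.card {p : F[X] // p.Monic ∧ p.natDegree = n} = q F ^ n := by
  rw [Nat.card_congr (monicEquivDegreeLT n), Nat.card_congr (degreeLTEquiv F n).toEquiv]
  simp [q]

instance finite_monic_natDegree (n : ℕ) : Finite {p : F[X] // p.Monic ∧ p.natDegree = n} :=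
  Nat.finite_of_card_ne_zero (by
    rw [card_monic_natDegree]; exact pow_ne_zero _ (by have := two_le_q (F := F); omega))

theorem finite_setOf_monic_natDegree (n : ℕ) : {p : F[X] | p.Monic ∧ p.natDegree = n}.Finite :=
  Set.finite_coe_iff.1 (finite_monic_natDegree n)

variable (F) in
/-- The finite set of monic polynomials of degree `n`. -/
noncomputable def monics (n : ℕ) : Finset F[X] :=
  Set.Finite.toFinset (finite_setOf_monic_natDegree (F := F) n)

@[simp]
theorem mem_monics {n : ℕ} {p : F[X]} : p ∈ monics F n ↔ p.Monic ∧ p.natDegree = n := by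
  simp [monics]

theorem card_monics (n : ℕ) : (monics F n).card = q F ^ n := by
  rw [← card_monic_natDegree, monics,
    ← Set.ncard_eq_toFinset_card _ (finite_setOf_monic_natDegree n), ← Nat.card_coe_set_eq]
  rfl

theorem two_le_pnorm (P : MonicPrime F) : 2 ≤ pnorm P.1 := by
  have h := P.2.2.natDegree_pos
  calc 2 ≤ q F := two_le_q
    _ = q F ^ 1 := (pow_one _).symm
    _ ≤ pnorm P.1 := Nat.pow_le_pow_right (by have := two_le_q (F := F); omega) h

/-- There are at most $q^n$ monic primes of degree $n$, so grouping by degree gives a geometric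
majorant of ratio $q^{1-\sigma}$. -/
theorem summable_pnorm_rpow {σ : ℝ} (hσ : 1 < σ) :
    Summable fun P : MonicPrime F => (pnorm P.1 : ℝ) ^ (-σ) := by
  have hq : (2 : ℝ) ≤ q F := by exact_mod_cast two_le_q
  have hq0 : (0 : ℝ) < q F := by linarith
  let e := Equiv.sigmaFiberEquiv fun P : MonicPrime F => P.1.natDegree
  have hinj : ∀ n : ℕ, Function.Injective
      (fun y : {P : MonicPrime F // P.1.natDegree = n} =>
        (⟨y.1.1, y.1.2.1, y.2⟩ : {p : F[X] // p.Monic ∧ p.natDegree = n})) := by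
    intro n x y h
    exact Subtype.ext (Subtype.ext (by simpa using h))
  have hfin : ∀ n : ℕ, Finite {P : MonicPrime F // P.1.natDegree = n} := fun n =>
    Finite.of_injective _ (hinj n)
  rw [← e.summable_iff, summable_sigma_of_nonneg (f := _ ∘ e)
    (fun _ => Real.rpow_nonneg (Nat.cast_nonneg _) _)]
  refine ⟨fun n => ?_, ?_⟩
  · have := hfin n
    exact Summable.of_finite
  · refine Summable.of_nonneg_of_le (fun n => tsum_nonneg fun _ =>
      Real.rpow_nonneg (Nat.cast_nonneg _) _) (fun n => ?_)
      (summable_geometric_of_lt_one (r := (q F : ℝ) ^ (1 - σ)) (by positivity)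
        (Real.rpow_lt_one_of_one_lt_of_neg (by linarith) (by linarith)))
    have hterm : ∀ y : {P : MonicPrime F // P.1.natDegree = n},
        ((fun P : MonicPrime F => (pnorm P.1 : ℝ) ^ (-σ)) ∘ e) ⟨n, y⟩ =
          ((q F : ℝ) ^ n) ^ (-σ) := by
      intro y
      simp [e, pnorm, y.2]
    have := hfin n
    have := Fintype.ofFinite {P : MonicPrime F // P.1.natDegree = n}
    rw [tsum_congr hterm, tsum_const, nsmul_eq_mul]
    have hc : Nat.card {P : MonicPrime F // P.1.natDegree = n} ≤ q F ^ n := by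
      rw [← card_monic_natDegree]
      exact Nat.card_le_card_of_injective _ (hinj n)
    calc (Nat.card {P : MonicPrime F // P.1.natDegree = n} : ℝ) * ((q F : ℝ) ^ n) ^ (-σ)
        ≤ (q F : ℝ) ^ n * ((q F : ℝ) ^ n) ^ (-σ) := by
          gcongr
          exact_mod_cast hc
      _ = ((q F : ℝ) ^ (1 - σ)) ^ n := by
          rw [← Real.rpow_natCast, ← Real.rpow_natCast, ← Real.rpow_mul hq0.le,
            ← Real.rpow_mul hq0.le, ← Real.rpow_add hq0]
          congr 1; ring

/-! ### Convergence, holomorphy and nonvanishing of the Euler product. -/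

/-- The local parameters `|P|^{-1/2-z_j}`. -/
noncomputable def localParam {k : ℕ} (z : Fin k → ℂ) (P : MonicPrime F) (j : Fin k) : ℂ :=
  1 / (pnorm P.1 : ℂ) ^ (1 / 2 + z j)

theorem eulerFactor_eq {k : ℕ} (z : Fin k → ℂ) (P : MonicPrime F) :
    eulerFactor z P = pairProd (localParam z P) *
      (evenPart (localParam z P) + 1 / (pnorm P.1 : ℂ)) * (1 + 1 / (pnorm P.1 : ℂ))⁻¹ := by
  have hN : (pnorm P.1 : ℂ) ≠ 0 := by
    have := two_le_pnorm P
    exact_mod_cast (by omega : pnorm P.1 ≠ 0)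
  unfold eulerFactor pairProd evenPart localParam
  congr 2
  refine Finset.prod_congr rfl fun i _ => Finset.prod_congr rfl fun j _ => ?_
  rw [div_mul_div_comm, ← Complex.cpow_add _ _ hN]
  congr 3
  · ring
  · ring

theorem norm_localParam_le {k : ℕ} {r : ℝ} {z : Fin k → ℂ} (hz : ∀ j, ‖z j‖ ≤ r)
    (P : MonicPrime F) (j : Fin k) :
    ‖localParam z P j‖ ≤ (pnorm P.1 : ℝ) ^ (-(1 / 2 - r)) := by
  have hN2 : (2 : ℝ) ≤ pnorm P.1 := by exact_mod_cast two_le_pnorm P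
  have hN : (0 : ℝ) < pnorm P.1 := by linarith
  rw [localParam, norm_div, norm_one, one_div, Complex.norm_natCast_cpow_of_pos
    (by exact_mod_cast hN), ← Real.rpow_neg hN.le]
  refine Real.rpow_le_rpow_of_exponent_le (by linarith) ?_
  have h := (abs_le.1 ((Complex.abs_re_le_norm (z j)).trans (hz j))).1
  have : ((1 / 2 + z j : ℂ)).re = 1 / 2 + (z j).re := by simp
  rw [this]; linarith

theorem norm_localParam_lt_one {k : ℕ} {r : ℝ} (hr : r < 1 / 4) {z : Fin k → ℂ}
    (hz : ∀ j, ‖z j‖ ≤ r) (P : MonicPrime F) (j : Fin k) : ‖localParam z P j‖ < 1 := by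
  have hN2 : (2 : ℝ) ≤ pnorm P.1 := by exact_mod_cast two_le_pnorm P
  exact (norm_localParam_le hz P j).trans_lt
    (Real.rpow_lt_one_of_one_lt_of_neg (by linarith) (by linarith))

/-- The difference is $\bigl((\text{pair}\cdot\text{even}-1)+(\text{pair}-1)/|P|\bigr)/(1+1/|P|)$,
and both terms have order four in $|P|^{-1/2+r}$. The exponent $2-4r$ exceeds $1$ exactly when
$r<\frac14$, which is where that bound on the radius comes from. -/
theorem eulerFactor_sub_one_bound (k : ℕ) {r : ℝ} (hr0 : 0 ≤ r) (hr : r < 1 / 4) :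
    ∃ C, ∀ (P : MonicPrime F) (z : Fin k → ℂ), (∀ j, ‖z j‖ ≤ r) →
      ‖eulerFactor z P - 1‖ ≤ C * (pnorm P.1 : ℝ) ^ (-(2 - 4 * r)) := by
  let α := MonicPrime F × {z : Fin k → ℂ // ∀ j, ‖z j‖ ≤ r}
  let ρ : α → ℝ := fun t => (pnorm t.1.1 : ℝ) ^ (-(1 / 2 - r))
  have hN2 : ∀ P : MonicPrime F, (2 : ℝ) ≤ pnorm P.1 := fun P => by exact_mod_cast two_le_pnorm P
  have hρ0 : ∀ t, 0 ≤ ρ t := fun t => by positivity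
  have hρ1 : ∀ t, ρ t ≤ 1 := fun t =>
    (Real.rpow_le_one_of_one_le_of_nonpos (by linarith [hN2 t.1]) (by linarith))
  -- Along the filter `⊤` on pairs $(P,z)$, a big-O statement is a bound with a single constant,
  -- uniform in $P$ and $z$.
  have hρ : ρ =O[⊤] fun _ => (1 : ℝ) :=
    isBigO_top.2 ⟨1, fun t => by simpa [abs_of_nonneg (hρ0 t)] using hρ1 t⟩
  obtain ⟨h1, h2, -⟩ := pairProd_isBigO hρ k (fun t : α => localParam t.2.1 t.1)
    (fun j => isBigO_top.2 ⟨1, fun t => by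
      rw [one_mul, Real.norm_of_nonneg (hρ0 t)]
      exact norm_localParam_le t.2.2 t.1 j⟩)
    (fun t j h => by
      have h3 := norm_localParam_lt_one hr t.2.2 t.1 j
      have h4 : ‖localParam t.2.1 t.1 j‖ ^ 2 = 1 := by
        rw [← norm_pow, ← sub_eq_zero.1 h, norm_one]
      nlinarith [norm_nonneg (localParam t.2.1 t.1 j)])
  have h3 : (fun t : α => 1 / (pnorm t.1.1 : ℂ)) =O[⊤] fun t => ρ t ^ 2 := by
    refine isBigO_top.2 ⟨1, fun t => ?_⟩
    have hN := hN2 t.1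
    rw [norm_div, norm_one, Complex.norm_natCast, one_mul, Real.norm_of_nonneg (by positivity),
      ← Real.rpow_natCast, ← Real.rpow_mul (by linarith), one_div, ← Real.rpow_neg_one]
    refine Real.rpow_le_rpow_of_exponent_le (by linarith) ?_
    push_cast; linarith
  have hne : ∀ t : α, (1 + 1 / (pnorm t.1.1 : ℂ)) ≠ 0 := fun t h => by
    have hN := hN2 t.1
    have : (1 + 1 / (pnorm t.1.1 : ℝ)) = 0 := by
      rw [← Complex.ofReal_inj]; push_cast; exact h
    have h0 : 0 < 1 / (pnorm t.1.1 : ℝ) := by positivity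
    linarith
  have h4 : (fun t : α => (1 + 1 / (pnorm t.1.1 : ℂ))⁻¹) =O[⊤] fun _ => (1 : ℝ) := by
    refine isBigO_top.2 ⟨1, fun t => ?_⟩
    have h0 : (0 : ℝ) ≤ 1 / (pnorm t.1.1 : ℝ) := by positivity
    have e : (1 + 1 / (pnorm t.1.1 : ℂ)) = ((1 + 1 / (pnorm t.1.1 : ℝ) : ℝ) : ℂ) := by
      push_cast; rfl
    rw [e, norm_inv, Complex.norm_real, Real.norm_of_nonneg (by positivity)]
    simpa using inv_le_one_of_one_le₀ (le_add_of_nonneg_right h0)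
  have h5 := h1.mul h3
  simp only [← pow_add] at h5
  have h6 := (h2.add h5).mul h4
  obtain ⟨C, hC⟩ := isBigO_top.1 h6
  refine ⟨C, fun P z hz => ?_⟩
  have := hC (P, ⟨z, hz⟩)
  have e : (fun t : α => (pairProd (localParam t.2.1 t.1) * evenPart (localParam t.2.1 t.1) - 1 +
      (pairProd (localParam t.2.1 t.1) - 1) * (1 / (pnorm t.1.1 : ℂ))) *
      (1 + 1 / (pnorm t.1.1 : ℂ))⁻¹) = fun t => eulerFactor t.2.1 t.1 - 1 := by
    ext t
    rw [eulerFactor_eq]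
    have := hne t
    field_simp
    ring
  have e2 := congrFun e (P, ⟨z, hz⟩)
  dsimp only at e2 this
  rw [e2] at this
  refine this.trans (le_of_eq ?_)
  congr 1
  have hN := hN2 P
  rw [mul_one, Real.norm_of_nonneg (by positivity), ← Real.rpow_natCast,
    ← Real.rpow_mul (by linarith)]
  congr 1
  push_cast; ring

theorem isCompact_polydisc (k : ℕ) (r : ℝ) : IsCompact {z : Fin k → ℂ | ∀ i, ‖z i‖ ≤ r} := by
  have : {z : Fin k → ℂ | ∀ i, ‖z i‖ ≤ r} = Set.univ.pi fun _ => Metric.closedBall (0 : ℂ) r := by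
    ext z; simp
  rw [this]
  exact isCompact_univ_pi fun _ => isCompact_closedBall 0 r

theorem differentiable_update {k : ℕ} (z : Fin k → ℂ) (i : Fin k) :
    Differentiable ℂ fun x => Function.update z i x := by
  refine differentiable_pi.2 fun j => ?_
  rcases eq_or_ne j i with rfl | h
  · simp
  · simp [h]

theorem differentiableAt_finset_prod {E ι : Type*} [NormedAddCommGroup E] [NormedSpace ℂ E]
    {s : Finset ι} {f : ι → E → ℂ} {z : E} (hf : ∀ i ∈ s, DifferentiableAt ℂ (f i) z) :
    DifferentiableAt ℂ (fun z => ∏ i ∈ s, f i z) z := by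
  induction s using Finset.induction_on with
  | empty => simp
  | insert a s ha ih =>
    simp only [Finset.prod_insert ha]
    exact (hf a (by simp)).fun_mul (ih fun i hi => hf i (by simp [hi]))

theorem differentiableAt_localParam {k : ℕ} (P : MonicPrime F) (j : Fin k) (z : Fin k → ℂ) :
    DifferentiableAt ℂ (fun z => localParam z P j) z := by
  have hN : (pnorm P.1 : ℂ) ≠ 0 := by
    have := two_le_pnorm P
    exact_mod_cast (by omega : pnorm P.1 ≠ 0)
  have hz : DifferentiableAt ℂ (fun z : Fin k → ℂ => 1 / 2 + z j) z := by fun_prop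
  have e : (fun z : Fin k → ℂ => localParam z P j) =
      fun z => ((pnorm P.1 : ℂ) ^ (1 / 2 + z j))⁻¹ := by
    ext z; rw [localParam, one_div]
  rw [e]
  exact (hz.const_cpow (Or.inl hN)).fun_inv (by simp [Complex.cpow_eq_zero_iff, hN])

theorem differentiableAt_eulerFactor {k : ℕ} {r : ℝ} (hr : r < 1 / 4) {z : Fin k → ℂ}
    (hz : ∀ j, ‖z j‖ ≤ r) (P : MonicPrime F) :
    DifferentiableAt ℂ (fun z : Fin k → ℂ => eulerFactor z P) z := by
  have hy := fun j => differentiableAt_localParam P j z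
  have hlt := fun j => norm_localParam_lt_one hr hz P j
  have h1 : ∀ j, 1 - localParam z P j ≠ 0 := fun j h => by
    have := hlt j
    rw [← sub_eq_zero.1 h, norm_one] at this
    exact lt_irrefl _ this
  have h2 : ∀ j, 1 + localParam z P j ≠ 0 := fun j h => by
    have := hlt j
    rw [eq_neg_of_add_eq_zero_right h, norm_neg, norm_one] at this
    exact lt_irrefl _ this
  simp only [eulerFactor_eq, pairProd, evenPart]
  refine (DifferentiableAt.fun_mul ?_ (DifferentiableAt.add_const _ ?_)).mul_const _
  · exact differentiableAt_finset_prod fun i _ => differentiableAt_finset_prod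
      fun j _ => ((hy i).fun_mul (hy j)).const_sub _
  · refine (DifferentiableAt.fun_add ?_ ?_).const_mul _
    · exact differentiableAt_finset_prod fun j _ => ((hy j).const_sub _).fun_inv (h1 j)
    · exact differentiableAt_finset_prod fun j _ => ((hy j).const_add _).fun_inv (h2 j)

section EulerProduct

variable {k : ℕ} {r : ℝ}

theorem summable_eulerFactor_sub_one (hr0 : 0 ≤ r) (hr : r < 1 / 4) {z : Fin k → ℂ}
    (hz : ∀ j, ‖z j‖ ≤ r) : Summable fun P : MonicPrime F => ‖eulerFactor z P - 1‖ := by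
  obtain ⟨C, hC⟩ := eulerFactor_sub_one_bound (F := F) k hr0 hr
  exact Summable.of_nonneg_of_le (fun _ => norm_nonneg _) (fun P => hC P z hz)
    ((summable_pnorm_rpow (by linarith)).mul_left C)

theorem multipliable_eulerFactor (hr0 : 0 ≤ r) (hr : r < 1 / 4) {z : Fin k → ℂ}
    (hz : ∀ j, ‖z j‖ ≤ r) : Multipliable fun P : MonicPrime F => eulerFactor z P := by
  simpa using multipliable_one_add_of_summable (summable_eulerFactor_sub_one (F := F) hr0 hr hz)

theorem tendstoUniformlyOn_A (hr0 : 0 ≤ r) (hr : r < 1 / 4) :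
    TendstoUniformlyOn (fun (s : Finset (MonicPrime F)) z => ∏ P ∈ s, eulerFactor z P)
      (A F) atTop {z : Fin k → ℂ | ∀ i, ‖z i‖ ≤ r} := by
  obtain ⟨C, hC⟩ := eulerFactor_sub_one_bound (F := F) k hr0 hr
  have h := Summable.hasProdUniformlyOn_one_add (f := fun (P : MonicPrime F) z =>
    eulerFactor z P - 1) (isCompact_polydisc k r)
    ((summable_pnorm_rpow (F := F) (σ := 2 - 4 * r) (by linarith)).mul_left C)
    (Eventually.of_forall fun P z hz => hC P z hz)
    (fun P z hz => ((differentiableAt_eulerFactor hr hz P).sub_const 1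
      ).continuousAt.continuousWithinAt)
  simp only [hasProdUniformlyOn_iff_tendstoUniformlyOn, add_sub_cancel] at h
  exact h

theorem continuousOn_A (hr0 : 0 ≤ r) (hr : r < 1 / 4) :
    ContinuousOn (A F) {z : Fin k → ℂ | ∀ i, ‖z i‖ ≤ r} := by
  refine (tendstoUniformlyOn_A hr0 hr).continuousOn (Frequently.of_forall fun s z hz => ?_)
  exact (differentiableAt_finset_prod fun P _ =>
    differentiableAt_eulerFactor hr hz P).continuousAt.continuousWithinAt

/-- Weierstrass's theorem on a disc in one coordinate. Separate holomorphy together with joint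
continuity is all that shrinking the contours requires. -/
theorem differentiableAt_A_update (hr0 : 0 ≤ r) (hr : r < 1 / 4) {z : Fin k → ℂ}
    (hz : ∀ j, ‖z j‖ ≤ r) (i : Fin k) (hi : ‖z i‖ < r) :
    DifferentiableAt ℂ (fun x => A F (Function.update z i x)) (z i) := by
  have hmem : ∀ x ∈ Metric.ball (0 : ℂ) r, ∀ j, ‖Function.update z i x j‖ ≤ r := by
    intro x hx j
    rcases eq_or_ne j i with rfl | h
    · simpa using (mem_ball_zero_iff.1 hx).le
    · simpa [h] using hz j
  have hu := ((tendstoUniformlyOn_A (F := F) hr0 hr).comp (Function.update z i)).mono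
    (s' := Metric.ball 0 r) hmem
  have hd := hu.tendstoLocallyUniformlyOn.differentiableOn (Eventually.of_forall fun s x hx => ?_)
    Metric.isOpen_ball
  · exact hd.differentiableAt (Metric.isOpen_ball.mem_nhds (by simpa using hi))
  · refine DifferentiableAt.differentiableWithinAt ?_
    refine DifferentiableAt.comp x (g := fun z : Fin k → ℂ => ∏ P ∈ s, eulerFactor z P) ?_
      (differentiable_update z i x)
    exact differentiableAt_finset_prod fun P _ => differentiableAt_eulerFactor hr (hmem x hx) P

/-- At the centre all local parameters equal the real number $|P|^{-1/2}\in(0,1)$, and every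
constituent of the factor is positive. -/
theorem eulerFactor_zero_ne_zero (P : MonicPrime F) : eulerFactor (0 : Fin k → ℂ) P ≠ 0 := by
  have hN2 : (2 : ℝ) ≤ pnorm P.1 := by exact_mod_cast two_le_pnorm P
  set N : ℝ := (pnorm P.1 : ℝ) with hN
  set y : ℝ := 1 / N ^ (1 / 2 : ℝ) with hy
  have hy0 : 0 < y := by positivity
  have hy1 : y < 1 := by
    rw [hy, div_lt_one (by positivity)]
    exact Real.one_lt_rpow (by linarith) (by norm_num)
  have hloc : localParam (0 : Fin k → ℂ) P = fun _ => (y : ℂ) := by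
    ext j
    simp only [localParam, Pi.zero_apply, add_zero, hy, Complex.ofReal_div, Complex.ofReal_one]
    rw [Complex.ofReal_cpow (by linarith)]
    push_cast
    simp [hN]
  have e : eulerFactor (0 : Fin k → ℂ) P = (((∏ i : Fin k, ∏ j ∈ Finset.Ici i, (1 - y * y)) *
      (1 / 2 * ((∏ _j : Fin k, (1 - y)⁻¹) + ∏ _j : Fin k, (1 + y)⁻¹) + 1 / N) *
      (1 + 1 / N)⁻¹ : ℝ) : ℂ) := by
    rw [eulerFactor_eq, hloc]
    simp only [pairProd, evenPart]
    push_cast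
    simp [hN]
  rw [e, Complex.ofReal_ne_zero]
  have h1 : 0 < 1 - y * y := by nlinarith
  have h2 : 0 < 1 - y := by linarith
  have h3 : 0 < N := by linarith
  have h4 : 0 < ∏ i : Fin k, ∏ j ∈ Finset.Ici i, (1 - y * y) :=
    Finset.prod_pos fun i _ => Finset.prod_pos fun j _ => h1
  have h5 : 0 < ∏ _j : Fin k, (1 - y)⁻¹ := Finset.prod_pos fun i _ => inv_pos.2 h2
  have h6 : 0 < ∏ _j : Fin k, (1 + y)⁻¹ := Finset.prod_pos fun i _ => by positivity
  positivity

theorem A_zero_ne_zero : A F (0 : Fin k → ℂ) ≠ 0 := by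
  have := tprod_one_add_ne_zero_of_summable
    (f := fun P : MonicPrime F => eulerFactor (0 : Fin k → ℂ) P - 1)
    (fun P => by simpa using eulerFactor_zero_ne_zero P)
    (summable_eulerFactor_sub_one (r := 1 / 8) (by norm_num) (by norm_num) (by simp))
  simpa [A] using this

end EulerProduct

/-! ### Splitting and rescaling the integrand of `Q`. -/

variable (F) in
/-- The function `s / (1 - q^{-s})`, i.e. `s ζ_A(1 + s)` with its singularity at `0` removed. -/
noncomputable def zetaReg (s : ℂ) : ℂ :=
  (dslope (fun s : ℂ => 1 - Complex.exp (-(Real.log (q F) * s))) 0 s)⁻¹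

theorem log_q_pos : 0 < Real.log (q F) :=
  Real.log_pos (by exact_mod_cast lt_of_lt_of_le one_lt_two (two_le_q (F := F)))

theorem q_cpow (s : ℂ) : (q F : ℂ) ^ s = Complex.exp (Real.log (q F) * s) := by
  have : (q F : ℂ) ≠ 0 := by
    have := two_le_q (F := F)
    exact_mod_cast (by omega : q F ≠ 0)
  rw [Complex.cpow_def_of_ne_zero this, Complex.natCast_log]

omit [Field F] in
theorem zetaReg_zero : zetaReg F 0 = (Real.log (q F) : ℂ)⁻¹ := by
  rw [zetaReg, dslope_same]
  congr 1
  have : HasDerivAt (fun s : ℂ => 1 - Complex.exp (-(Real.log (q F) * s)))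
      (-(Complex.exp (-(Real.log (q F) * 0)) * -(Real.log (q F) * 1))) 0 :=
    ((((hasDerivAt_id (0 : ℂ)).const_mul (Real.log (q F) : ℂ)).neg).cexp).const_sub 1
  rw [this.deriv]; simp

theorem zetaReg_of_ne {s : ℂ} (hs : s ≠ 0) : zetaReg F s = s * zetaA F (1 + s) := by
  rw [zetaReg, dslope_of_ne _ hs, slope_def_field, zetaA, q_cpow]
  simp [div_eq_mul_inv, mul_comm]

/-- The zeros of $1-q^{-s}$ are $2\pi in/\log q$, and the one at $0$ has been divided out. Applied
to $s=z_i+z_j$ with $|s|\le2r$, this uses $r<\pi/\log q$. -/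
theorem differentiableAt_zetaReg {s : ℂ} (hs : ‖s‖ < 2 * Real.pi / Real.log (q F)) :
    DifferentiableAt ℂ (zetaReg F) s := by
  have hl := log_q_pos (F := F)
  have hd : Differentiable ℂ (dslope (fun s : ℂ => 1 - Complex.exp (-(Real.log (q F) * s))) 0) := by
    rw [← differentiableOn_univ, Complex.differentiableOn_dslope Filter.univ_mem]
    fun_prop
  refine (hd s).inv ?_
  intro h
  rcases eq_or_ne s 0 with rfl | h0
  · have := zetaReg_zero (F := F)
    rw [zetaReg, h, inv_zero, eq_comm, inv_eq_zero, Complex.ofReal_eq_zero] at this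
    exact hl.ne' this
  · rw [dslope_of_ne _ h0, slope_def_field] at h
    simp only [mul_zero, neg_zero, Complex.exp_zero, sub_self, sub_zero, div_eq_zero_iff, h0,
      or_false, sub_eq_zero] at h
    obtain ⟨n, hn⟩ := Complex.exp_eq_one_iff.1 h.symm
    have hnorm : Real.log (q F) * ‖s‖ = |(n : ℝ)| * (2 * Real.pi) := by
      have := congrArg norm hn
      rw [norm_neg, norm_mul, Complex.norm_real, Real.norm_of_nonneg hl.le] at this
      simpa [abs_of_pos Real.pi_pos] using this
    rw [lt_div_iff₀ hl] at hs
    have hn0 : n ≠ 0 := by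
      rintro rfl
      rw [Int.cast_zero, abs_zero, zero_mul, mul_eq_zero, norm_eq_zero] at hnorm
      exact hnorm.elim hl.ne' h0
    have : (1 : ℝ) ≤ |(n : ℝ)| := by exact_mod_cast Int.one_le_abs hn0
    nlinarith [Real.pi_pos]

variable (F) in
/-- The elementary regular factor of the integrand of `Q`. -/
noncomputable def regElem {k : ℕ} (z : Fin k → ℂ) : ℂ :=
  (∏ j, Complex.exp (-(Real.log (q F) * z j / 2))) *
    ∏ i : Fin k, ∏ j ∈ Finset.Ici i, zetaReg F (z i + z j)

/-- The singular factor of the integrand of `Q`. -/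
noncomputable def singFactor {k : ℕ} (c : ℂ) (z : Fin k → ℂ) : ℂ :=
  vand z * vand (fun j => z j ^ 2) * ∏ j, (Complex.exp (c * z j) / z j ^ (2 * k))

theorem prod_prod_Ici {k : ℕ} (f : Fin k → Fin k → ℂ) :
    ∏ i, ∏ j ∈ Finset.Ici i, f i j = (∏ i, f i i) * ∏ i, ∏ j ∈ Finset.Ioi i, f i j := by
  rw [← Finset.prod_mul_distrib]
  refine Finset.prod_congr rfl fun i _ => ?_
  rw [← Finset.Ioi_insert i, Finset.prod_insert (by simp)]

theorem prod_prod_Ici_const (k : ℕ) (c : ℂ) :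
    ∏ i : Fin k, ∏ _j ∈ Finset.Ici i, c = c ^ (k * (k + 1) / 2) := by
  rw [prod_prod_Ici, prod_prod_Ioi_const, Finset.prod_const, Finset.card_univ, Fintype.card_fin,
    ← pow_add]
  rw [triangle_succ, add_comm]

/-- Here $X(\frac12+z)=q^z$; the bound on $r$ keeps $z\log q$ in the strip
$|\operatorname{Im}|<\pi$, where the principal logarithm inverts the exponential. -/
theorem X'_cpow {r : ℝ} (hr : r < Real.pi / Real.log (q F)) {z : ℂ} (hz : ‖z‖ ≤ r) :
    X' F (1 / 2 + z) ^ (-(1 / 2) : ℂ) = Complex.exp (-(Real.log (q F) * z / 2)) := by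
  have hl := log_q_pos (F := F)
  rw [lt_div_iff₀ hl] at hr
  have him : |((Real.log (q F) : ℂ) * z).im| < Real.pi := by
    refine (Complex.abs_im_le_norm _).trans_lt ?_
    rw [norm_mul, Complex.norm_real, Real.norm_of_nonneg hl.le, mul_comm]
    exact (mul_le_mul_of_nonneg_right hz hl.le).trans_lt hr
  rw [X', q_cpow, show -(1 / 2 : ℂ) + (1 / 2 + z) = z by ring,
    Complex.cpow_def_of_ne_zero (Complex.exp_ne_zero _),
    Complex.log_exp (abs_lt.1 him).1 (abs_lt.1 him).2.le]
  congr 1; ring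

/-- The integrand of `Q` as a product of a regular factor and a singular one. -/
theorem integrand_eq {k : ℕ} (hk : 1 ≤ k) {r : ℝ} (hr : r < Real.pi / Real.log (q F))
    {z : Fin k → ℂ} (hz : ∀ j, ‖z j‖ ≤ r) (h0 : ∀ j, z j ≠ 0) (x : ℂ) :
    G F z * vand (fun j => z j ^ 2) ^ 2 / (∏ j : Fin k, z j ^ (2 * k - 1)) *
      (q F : ℂ) ^ (x / 2 * ∑ j : Fin k, z j) =
    (1 / 2) ^ k * (A F z * regElem F z * singFactor (x / 2 * Real.log (q F)) z) := by
  have hX : ∏ j : Fin k, X' F (1 / 2 + z j) ^ (-(1 / 2) : ℂ) =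
      ∏ j, Complex.exp (-(Real.log (q F) * z j / 2)) :=
    Finset.prod_congr rfl fun j _ => X'_cpow hr (hz j)
  -- Where $z_i+z_j=0$ the Vandermonde factor vanishes, so both sides are zero whatever value
  -- `zetaA` takes at its pole.
  have hpair : vand (fun j => z j ^ 2) ^ 2 *
      ∏ i : Fin k, ∏ j ∈ Finset.Ioi i, zetaA F (1 + z i + z j) =
      vand z * vand (fun j => z j ^ 2) *
        ∏ i : Fin k, ∏ j ∈ Finset.Ioi i, zetaReg F (z i + z j) := by
    simp only [vand, ← Finset.prod_pow, ← Finset.prod_mul_distrib]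
    refine Finset.prod_congr rfl fun i _ => Finset.prod_congr rfl fun j _ => ?_
    rcases eq_or_ne (z i + z j) 0 with h | h
    · have : z j ^ 2 - z i ^ 2 = 0 := by linear_combination (z j - z i) * h
      rw [this]; ring
    · rw [zetaReg_of_ne h, add_assoc]; ring
  -- The diagonal poles $1/(2z_i)$ supply the $2^{-k}$ that cancels the $2^k$ in `Q`, and raise the
  -- exponent $2k-1$ to $2k$.
  have hdiag : ∏ i : Fin k, zetaA F (1 + z i + z i) =
      (1 / 2) ^ k * ((∏ i : Fin k, zetaReg F (z i + z i)) * ∏ i : Fin k, (z i)⁻¹) := by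
    rw [← Finset.prod_mul_distrib, ← Fin.prod_const, ← Finset.prod_mul_distrib]
    refine Finset.prod_congr rfl fun i _ => ?_
    have h2 : z i + z i ≠ 0 := by rw [← two_mul]; exact mul_ne_zero two_ne_zero (h0 i)
    rw [zetaReg_of_ne h2, add_assoc]
    have := h0 i
    field_simp
    ring
  have hexp : (q F : ℂ) ^ (x / 2 * ∑ j : Fin k, z j) =
      ∏ j, Complex.exp (x / 2 * Real.log (q F) * z j) := by
    rw [q_cpow, ← Complex.exp_sum, ← Finset.mul_sum]
    congr 1; ring
  have hpow : (∏ j : Fin k, z j ^ (2 * k - 1))⁻¹ * ∏ i : Fin k, (z i)⁻¹ =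
      ∏ j : Fin k, (z j ^ (2 * k))⁻¹ := by
    rw [← Finset.prod_inv_distrib, ← Finset.prod_mul_distrib]
    refine Finset.prod_congr rfl fun i _ => ?_
    rw [← mul_inv, ← pow_succ, Nat.sub_add_cancel (by omega)]
  unfold G regElem singFactor
  rw [hX, prod_prod_Ici (fun i j => zetaA F (1 + z i + z j)), prod_prod_Ici, hdiag, hexp]
  simp only [div_eq_mul_inv _ (z _ ^ (2 * k)), Finset.prod_mul_distrib]
  rw [← hpow, div_eq_mul_inv]
  set a := A F z
  set e1 := ∏ j, Complex.exp (-(Real.log (q F) * z j / 2))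
  set e2 := ∏ j, Complex.exp (x / 2 * Real.log (q F) * z j)
  set p1 := (∏ j : Fin k, z j ^ (2 * k - 1))⁻¹
  set p2 := ∏ i : Fin k, (z i)⁻¹
  set d := ∏ i : Fin k, zetaReg F (z i + z i)
  linear_combination (a * e1 * e2 * p1 * p2 * d * (1 / 2) ^ k) * hpair

theorem vand_smul {k : ℕ} (c : ℂ) (w : Fin k → ℂ) :
    vand (fun j => c * w j) = c ^ (k * (k - 1) / 2) * vand w := by
  rw [← prod_prod_Ioi_const]
  simp only [vand, ← Finset.prod_mul_distrib, mul_sub]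

/-- With $m=k(k-1)/2$, the degrees in $\rho$ are $k$ from the differentials, $m$ and $2m$ from the
Vandermonde factors and $-2k^2=-4m-2k$ from the denominators: in total $-(m+k)=-k(k+1)/2$. -/
theorem singFactor_scale {k : ℕ} {c ρ : ℂ} (h : c * ρ = 1) (w : Fin k → ℂ) :
    ρ ^ k * singFactor c (fun j => ρ * w j) = c ^ (k * (k + 1) / 2) * singFactor 1 w := by
  have hc : c ≠ 0 := left_ne_zero_of_mul_eq_one h
  obtain rfl : ρ = c⁻¹ := eq_inv_of_mul_eq_one_right h
  have he : ∀ j, Complex.exp (c * (c⁻¹ * w j)) = Complex.exp (1 * w j) := fun j => by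
    rw [mul_inv_cancel_left₀ hc, one_mul]
  have hm := triangle_succ k
  have hk := mul_self_eq_triangle k
  unfold singFactor
  simp only [he, mul_pow, vand_smul, div_eq_mul_inv, mul_inv, Finset.prod_mul_distrib,
    Finset.prod_const, Finset.card_univ, Fintype.card_fin, hm]
  generalize k * (k - 1) / 2 = m at *
  have e : ((c⁻¹ ^ (2 * k))⁻¹) ^ k = c ^ (4 * m + 2 * k) := by
    rw [inv_pow c, inv_inv, ← pow_mul, mul_assoc, hk]; congr 1; ring
  rw [e]
  have e2 : c⁻¹ ^ k * c⁻¹ ^ m * (c⁻¹ ^ 2) ^ m * c ^ (4 * m + 2 * k) = c ^ (m + k) := by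
    rw [← pow_mul, ← pow_add, ← pow_add, inv_pow, inv_mul_eq_iff_eq_mul₀ (pow_ne_zero _ hc),
      ← pow_add]
    congr 1; ring
  linear_combination (vand w * vand (fun j => w j ^ 2) * ((∏ j, Complex.exp (1 * w j)) *
    ∏ j, (w j ^ (2 * k))⁻¹)) * e2

theorem differentiableAt_singFactor {k : ℕ} (c : ℂ) {z : Fin k → ℂ} (h0 : ∀ j, z j ≠ 0) :
    DifferentiableAt ℂ (singFactor c) z := by
  have hv : ∀ n : ℕ, DifferentiableAt ℂ (fun z : Fin k → ℂ => vand fun j => z j ^ n) z := by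
    intro n
    unfold vand
    exact differentiableAt_finset_prod fun i _ => differentiableAt_finset_prod fun j _ => by
      fun_prop
  have h1 : DifferentiableAt ℂ (fun z : Fin k → ℂ => vand z) z := by simpa using hv 1
  unfold singFactor
  refine (h1.fun_mul (hv 2)).fun_mul (differentiableAt_finset_prod fun j _ => ?_)
  simp only [div_eq_mul_inv]
  refine DifferentiableAt.fun_mul (by fun_prop) (DifferentiableAt.fun_inv (by fun_prop) ?_)
  exact pow_ne_zero _ (h0 j)

theorem differentiableAt_regElem {k : ℕ} {r : ℝ} (hr : r < Real.pi / Real.log (q F))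
    {z : Fin k → ℂ} (hz : ∀ j, ‖z j‖ ≤ r) : DifferentiableAt ℂ (regElem F) z := by
  unfold regElem
  refine DifferentiableAt.fun_mul (differentiableAt_finset_prod fun j _ => ?_)
    (differentiableAt_finset_prod fun i _ => differentiableAt_finset_prod fun j _ => ?_)
  · simp only [div_eq_mul_inv]; fun_prop
  · refine DifferentiableAt.comp z (g := zetaReg F) (differentiableAt_zetaReg ?_) (by fun_prop)
    calc ‖z i + z j‖ ≤ r + r := (norm_add_le _ _).trans (add_le_add (hz i) (hz j))
      _ < Real.pi / Real.log (q F) + Real.pi / Real.log (q F) := add_lt_add hr hr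
      _ = 2 * Real.pi / Real.log (q F) := by ring

omit [Field F] in
theorem regElem_zero (k : ℕ) :
    regElem F (0 : Fin k → ℂ) = ((Real.log (q F) : ℂ)⁻¹) ^ (k * (k + 1) / 2) := by
  simp only [regElem, Pi.zero_apply, mul_zero, zero_div, neg_zero, Complex.exp_zero,
    Finset.prod_const_one, one_mul, add_zero, zetaReg_zero, prod_prod_Ici_const]

/-- Rescaled form of `Q`, after shrinking the contours to radius `1 / c`. -/
theorem Q_eq_rescaled {k : ℕ} (hk : 1 ≤ k) {r : ℝ} (hr0 : 0 < r) (hr1 : r < 1 / 4)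
    (hr2 : r < Real.pi / Real.log (q F)) {x c : ℝ} (hc0 : 0 < c) (hcr : 1 / c ≤ r)
    (hc : c = x / 2 * Real.log (q F)) :
    Q F k r x = (c : ℂ) ^ (k * (k + 1) / 2) *
      ((-1) ^ (k * (k - 1) / 2) / (k ! : ℂ) * (1 / (2 * (Real.pi : ℂ) * Complex.I) ^ k) *
        torusIntegral (fun w : Fin k → ℂ =>
          A F (fun i => ((1 / c : ℝ) : ℂ) * w i) * regElem F (fun i => ((1 / c : ℝ) : ℂ) * w i) *
            singFactor 1 w) 0 (fun _ => 1)) := by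
  have hρ0 : 0 < 1 / c := by positivity
  set f : (Fin k → ℂ) → ℂ := fun z => A F z * regElem F z * singFactor (c : ℂ) z with hf
  have hsub : ∀ z : Fin k → ℂ, (∀ i, ‖z i‖ ∈ Set.Icc (1 / c) r) →
      (∀ i, ‖z i‖ ≤ r) ∧ ∀ i, z i ≠ 0 := fun z hz =>
    ⟨fun i => (hz i).2, fun i h => by
      have := (hz i).1
      rw [h, norm_zero] at this
      linarith⟩
  have hint : torusIntegral (fun z : Fin k → ℂ =>
        G F z * vand (fun j => z j ^ 2) ^ 2 / (∏ j : Fin k, z j ^ (2 * k - 1)) *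
          (q F : ℂ) ^ ((x : ℂ) / 2 * ∑ j : Fin k, z j)) 0 (fun _ => r) =
      (1 / 2) ^ k * torusIntegral f 0 (fun _ => r) := by
    rw [← torusIntegral_const_mul]
    unfold torusIntegral
    congr 1
    ext θ
    congr 1
    have hn := norm_torusMap_zero (R := fun _ : Fin k => r) (fun _ => hr0.le) θ
    beta_reduce
    rw [integrand_eq hk hr2 (fun j => (hn j).le) (fun j h => by
      have := hn j
      rw [h, norm_zero] at this
      exact hr0.ne this)]
    simp only [hc]
    push_cast
    rfl
  have hshrink : torusIntegral f 0 (fun _ => r) = torusIntegral f 0 (fun _ => 1 / c) := by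
    refine torusIntegral_shrink hρ0 hcr ?_ ?_
    · refine ContinuousOn.mul (ContinuousOn.mul ?_ ?_) ?_
      · exact (continuousOn_A hr0.le hr1).mono fun z hz => (hsub z hz).1
      · exact fun z hz =>
          (differentiableAt_regElem hr2 (hsub z hz).1).continuousAt.continuousWithinAt
      · exact fun z hz =>
          (differentiableAt_singFactor _ (hsub z hz).2).continuousAt.continuousWithinAt
    · intro i z hz hi
      have hu : Function.update z i (z i) = z := Function.update_eq_self i z
      have h1 := differentiableAt_A_update (F := F) hr0.le hr1 (hsub z hz).1 i hi.2
      have h2 : DifferentiableAt ℂ (fun x => regElem F (Function.update z i x)) (z i) :=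
        DifferentiableAt.comp (z i) (g := regElem F)
          (by rw [hu]; exact differentiableAt_regElem hr2 (hsub z hz).1)
          (differentiable_update z i (z i))
      have h3 : DifferentiableAt ℂ (fun x => singFactor (c : ℂ) (Function.update z i x)) (z i) :=
        DifferentiableAt.comp (z i) (g := singFactor (c : ℂ))
          (by rw [hu]; exact differentiableAt_singFactor _ (hsub z hz).2)
          (differentiable_update z i (z i))
      exact (h1.fun_mul h2).fun_mul h3
  have hcρ : (c : ℂ) * ((1 / c : ℝ) : ℂ) = 1 := by
    have : (c : ℂ) ≠ 0 := by exact_mod_cast hc0.ne'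
    push_cast; field_simp
  have hscale : torusIntegral f 0 (fun _ => 1 / c) = (c : ℂ) ^ (k * (k + 1) / 2) *
      torusIntegral (fun w : Fin k → ℂ =>
          A F (fun i => ((1 / c : ℝ) : ℂ) * w i) * regElem F (fun i => ((1 / c : ℝ) : ℂ) * w i) *
            singFactor 1 w) 0 (fun _ => 1) := by
    rw [torusIntegral_scale, ← torusIntegral_const_mul, ← torusIntegral_const_mul]
    congr 1
    ext w
    simp only [hf]
    linear_combination (A F (fun i => ((1 / c : ℝ) : ℂ) * w i) *
      regElem F (fun i => ((1 / c : ℝ) : ℂ) * w i)) * singFactor_scale hcρ w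
  rw [Q, hint, hshrink, hscale]
  have h2 : (2 : ℂ) ^ k * (1 / 2) ^ k = 1 := by rw [← mul_pow]; norm_num
  linear_combination ((-1) ^ (k * (k - 1) / 2) / (k ! : ℂ) *
    (1 / (2 * (Real.pi : ℂ) * Complex.I) ^ k) * ((c : ℂ) ^ (k * (k + 1) / 2) *
      torusIntegral (fun w : Fin k → ℂ =>
          A F (fun i => ((1 / c : ℝ) : ℂ) * w i) * regElem F (fun i => ((1 / c : ℝ) : ℂ) * w i) *
            singFactor 1 w) 0 (fun _ => 1))) * h2

/-- As $1/c\to0$ the regular factor tends to its central value, containing $(\log q)^{-k(k+1)/2}$;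
since $c/g\to\log q$, this is compensated and the model residue remains. -/
theorem tendsto_Q_div {k : ℕ} (hk : 1 ≤ k) {r : ℝ} (hr0 : 0 < r) (hr1 : r < 1 / 4)
    (hr2 : r < Real.pi / Real.log (q F)) :
    Tendsto (fun g : ℕ => Q F k r (2 * (g : ℂ) + 1) / (g : ℂ) ^ (k * (k + 1) / 2)) atTop
      (nhds (A F (0 : Fin k → ℂ) *
        (2 ^ (k * (k + 1) / 2) * ∏ j ∈ Finset.Icc 1 k, ((j ! : ℂ) / ((2 * j)! : ℂ))))) := by
  have hl := log_q_pos (F := F)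
  set ℓ := Real.log (q F) with hℓ
  set m := k * (k + 1) / 2 with hm
  let c : ℕ → ℝ := fun g => (2 * (g : ℝ) + 1) / 2 * ℓ
  have hc0 : ∀ g, 0 < c g := fun g => by positivity
  have hctop : Tendsto c atTop atTop := by
    refine Tendsto.atTop_mul_const hl (Tendsto.atTop_div_const two_pos ?_)
    exact tendsto_atTop_add_const_right _ _
      (Tendsto.const_mul_atTop two_pos tendsto_natCast_atTop_atTop)
  have hcinv : Tendsto (fun g => 1 / c g) atTop (nhds 0) := by
    simpa using! hctop.inv_tendsto_atTop
  have hK : ContinuousOn (singFactor 1) {z : Fin k → ℂ | ∀ i, ‖z i‖ = 1} := fun z hz =>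
    (differentiableAt_singFactor 1 fun j h => by
      have := hz j
      rw [h, norm_zero] at this
      exact zero_ne_one this).continuousAt.continuousWithinAt
  have hH : ContinuousOn (fun z : Fin k → ℂ => A F z * regElem F z) {z | ∀ i, ‖z i‖ ≤ r} :=
    (continuousOn_A hr0.le hr1).mul fun z hz =>
      (differentiableAt_regElem hr2 hz).continuousAt.continuousWithinAt
  have hlim := (tendsto_torusIntegral_dilate hr0 hH hK hcinv).const_mul
    ((-1) ^ (k * (k - 1) / 2) / (k ! : ℂ) * (1 / (2 * (Real.pi : ℂ) * Complex.I) ^ k))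
  have hratio : Tendsto (fun g : ℕ => ((c g : ℂ) / (g : ℂ)) ^ m) atTop (nhds ((ℓ : ℂ) ^ m)) := by
    refine Tendsto.pow ?_ m
    have h0 : Tendsto (fun g : ℕ => ((g : ℝ))⁻¹) atTop (nhds 0) :=
      tendsto_inv_atTop_zero.comp tendsto_natCast_atTop_atTop
    have h1 : Tendsto (fun g : ℕ => (1 + (1 / 2) * ((g : ℝ))⁻¹) * ℓ) atTop
        (nhds ((1 + 1 / 2 * 0) * ℓ)) := ((h0.const_mul _).const_add _).mul_const _
    have h2 : Tendsto (fun g : ℕ => (((1 + (1 / 2) * ((g : ℝ))⁻¹) * ℓ : ℝ) : ℂ)) atTop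
        (nhds (ℓ : ℂ)) := by
      have := (Complex.continuous_ofReal.tendsto _).comp h1
      simpa [Function.comp_def] using this
    refine h2.congr' ?_
    filter_upwards [eventually_gt_atTop 0] with g hg
    have hg0 : (g : ℂ) ≠ 0 := by exact_mod_cast hg.ne'
    simp only [c]
    push_cast
    field_simp
  have hfin := hratio.mul hlim
  have hval : (ℓ : ℂ) ^ m * ((-1) ^ (k * (k - 1) / 2) / (k ! : ℂ) *
      (1 / (2 * (Real.pi : ℂ) * Complex.I) ^ k) * (A F (0 : Fin k → ℂ) *
        regElem F (0 : Fin k → ℂ) * torusIntegral (singFactor 1) (0 : Fin k → ℂ) fun _ => 1)) =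
      A F (0 : Fin k → ℂ) * (2 ^ m * ∏ j ∈ Finset.Icc 1 k, ((j ! : ℂ) / ((2 * j)! : ℂ))) := by
    rw [← torusIntegral_vand_mul_vand_sq k hk, regElem_zero, ← hm, ← hℓ, inv_pow]
    have hℓ0 : (ℓ : ℂ) ^ m ≠ 0 := pow_ne_zero _ (by exact_mod_cast hl.ne')
    have hs : (fun w : Fin k → ℂ => vand w * vand (fun j => w j ^ 2) *
        ∏ j, (Complex.exp (w j) / w j ^ (2 * k))) = singFactor 1 := by
      ext w; simp [singFactor]
    rw [hs]
    field_simp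
  rw [hval] at hfin
  refine hfin.congr' ?_
  have hsmall : ∀ᶠ g in atTop, 1 / c g ≤ r := hcinv.eventually (eventually_le_nhds hr0)
  filter_upwards [hsmall] with g hg
  have := Q_eq_rescaled hk hr0 hr1 hr2 (x := 2 * (g : ℝ) + 1) (hc0 g) hg rfl
  push_cast at this
  rw [this, div_pow]
  push_cast
  ring

/-! ### Multiplicities in factorizations of polynomials. -/

omit [Fintype F] in
theorem mem_primeDivisors {N : F[X]} (hN : N ≠ 0) {P : F[X]} :
    P ∈ primeDivisors N ↔ P.Monic ∧ Irreducible P ∧ P ∣ N := by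
  rw [primeDivisors, Multiset.mem_toFinset, Polynomial.mem_normalizedFactors_iff hN]
  tauto

omit [Fintype F] in
theorem pow_dvd_iff_le_count {N : F[X]} (hN : N ≠ 0) {P : F[X]} (hP : P.Monic)
    (hi : Irreducible P) (n : ℕ) : P ^ n ∣ N ↔ n ≤ (normalizedFactors N).count P := by
  rw [pow_dvd_iff_le_emultiplicity, emultiplicity_eq_count_normalizedFactors hi hN,
    hP.normalize_eq_self, Nat.cast_le]

omit [Fintype F] in
theorem multiplicity_eq_count {N : F[X]} (hN : N ≠ 0) {P : F[X]} (hP : P.Monic)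
    (hi : Irreducible P) : multiplicity P N = (normalizedFactors N).count P := by
  refine multiplicity_eq_of_emultiplicity_eq_some ?_
  rw [emultiplicity_eq_count_normalizedFactors hi hN, hP.normalize_eq_self]

omit [Fintype F] in
theorem sum_count_mul_natDegree {N : F[X]} (hN : N.Monic) :
    ∑ P ∈ primeDivisors N, (normalizedFactors N).count P * P.natDegree = N.natDegree := by
  have h1 : N = ∏ P ∈ primeDivisors N, P ^ (normalizedFactors N).count P := by
    rw [primeDivisors, ← Finset.prod_multiset_count, prod_normalizedFactors_eq hN.ne_zero,
      hN.normalize_eq_self]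
  conv_rhs => rw [h1]
  have hm : ∀ P ∈ primeDivisors N, P.Monic := fun P hP =>
    ((mem_primeDivisors hN.ne_zero).1 hP).1
  rw [natDegree_prod_of_monic _ _ fun P hP => (hm P hP).pow _]
  exact Finset.sum_congr rfl fun P hP => ((hm P hP).natDegree_pow _).symm

omit [Fintype F] in
theorem isCoprime_of_monic_irreducible {P R : F[X]} (hP : P.Monic) (hPi : Irreducible P)
    (hR : R.Monic) (hRi : Irreducible R) (h : P ≠ R) : IsCoprime P R := by
  rw [hPi.coprime_iff_not_dvd]
  intro hd
  exact h (eq_of_monic_of_associated hP hR (hPi.associated_of_dvd hRi hd))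

/-! ### Digit expansions -/

variable (F) in
/-- Families of digits `b ⟨P, i⟩`, to be read as the numerator over `P ^ (2 i + 1)`. -/
abbrev Digits : Type _ := (Σ _ : F[X], ℕ) →₀ F[X]

/-- Digits live at monic primes, and are reduced. -/
def IsReduced (b : Digits F) : Prop :=
  ∀ x, b x ≠ 0 → x.1.Monic ∧ Irreducible x.1 ∧ (b x).degree < x.1.degree

/-- The number of digits at `P`, up to the last one which does not vanish. -/
noncomputable def length (b : Digits F) (P : F[X]) : ℕ := (b.support.filter (·.1 = P)).sup (·.2 + 1)

/-- The primes at which some digit does not vanish. -/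
noncomputable def places (b : Digits F) : Finset F[X] := b.support.image Sigma.fst

/-- `∏ P ^ length_P`. -/
noncomputable def conductor (b : Digits F) : F[X] := ∏ P ∈ places b, P ^ length b P

omit [Fintype F] in
theorem lt_length {b : Digits F} {x : Σ _ : F[X], ℕ} (hx : b x ≠ 0) :
    x.2 < length b x.1 := by
  have : x.2 + 1 ≤ length b x.1 :=
    Finset.le_sup (f := fun y : Σ _ : F[X], ℕ => y.2 + 1) (by simp [hx])
  omega

omit [Fintype F] in
theorem mem_places {b : Digits F} {P : F[X]} : P ∈ places b ↔ ∃ i, b ⟨P, i⟩ ≠ 0 := by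
  simp only [places, Finset.mem_image, Finsupp.mem_support_iff, Sigma.exists]
  constructor
  · rintro ⟨P, i, h, rfl⟩
    exact ⟨i, h⟩
  · rintro ⟨i, h⟩
    exact ⟨P, i, h, rfl⟩

omit [Fintype F] in
theorem exists_length_eq {b : Digits F} {P : F[X]} (hP : P ∈ places b) :
    ∃ i, b ⟨P, i⟩ ≠ 0 ∧ length b P = i + 1 := by
  obtain ⟨i, hi⟩ := mem_places.1 hP
  obtain ⟨⟨R, j⟩, hj, hs⟩ := Finset.exists_mem_eq_sup (b.support.filter (·.1 = P))
    ⟨⟨P, i⟩, by simp [hi]⟩ (fun y : Σ _ : F[X], ℕ => y.2 + 1)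
  simp only [Finset.mem_filter, Finsupp.mem_support_iff] at hj
  obtain ⟨hj, rfl⟩ := hj
  exact ⟨j, hj, hs⟩

omit [Fintype F] in
theorem IsReduced.of_mem_places {b : Digits F} (hb : IsReduced b) {P : F[X]}
    (hP : P ∈ places b) : P.Monic ∧ Irreducible P := by
  obtain ⟨i, hi⟩ := mem_places.1 hP
  exact ⟨(hb _ hi).1, (hb _ hi).2.1⟩

omit [Fintype F] in
theorem IsReduced.monic_conductor {b : Digits F} (hb : IsReduced b) : (conductor b).Monic :=
  monic_prod_of_monic _ _ fun _ hP => (hb.of_mem_places hP).1.pow _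

-- Distinct places are coprime, so the conductor divides exactly when each prime power does. The
-- condition then reads digit by digit, which makes `box` a product set.
omit [Fintype F] in
theorem IsReduced.conductor_dvd_iff {b : Digits F} (hb : IsReduced b) (N : F[X]) :
    conductor b ∣ N ↔ ∀ x, b x ≠ 0 → x.1 ^ (x.2 + 1) ∣ N := by
  constructor
  · intro h x hx
    refine (pow_dvd_pow _ (lt_length hx)).trans ((Finset.dvd_prod_of_mem
      (fun P => P ^ length b P) ?_).trans h)
    exact mem_places.2 ⟨x.2, hx⟩
  · intro h
    refine Finset.prod_dvd_of_coprime ?_ fun P hP => ?_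
    · intro P hP R hR hne
      obtain ⟨h1, h2⟩ := hb.of_mem_places hP
      obtain ⟨h3, h4⟩ := hb.of_mem_places hR
      exact (isCoprime_of_monic_irreducible h1 h2 h3 h4 hne).pow
    · obtain ⟨i, hi, hl⟩ := exists_length_eq hP
      rw [hl]
      exact h ⟨P, i⟩ hi

/-- The positions of digits allowed by a monic polynomial `N`. -/
noncomputable def positions (N : F[X]) : Finset (Σ _ : F[X], ℕ) :=
  (primeDivisors N).sigma fun P => Finset.range ((normalizedFactors N).count P)

omit [Fintype F] in
theorem mem_positions {N : F[X]} (hN : N ≠ 0) {x : Σ _ : F[X], ℕ} :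
    x ∈ positions N ↔ x.1.Monic ∧ Irreducible x.1 ∧ x.1 ^ (x.2 + 1) ∣ N := by
  rw [positions, Finset.mem_sigma, mem_primeDivisors hN, Finset.mem_range]
  constructor
  · rintro ⟨⟨h1, h2, -⟩, h3⟩
    exact ⟨h1, h2, (pow_dvd_iff_le_count hN h1 h2 _).2 h3⟩
  · rintro ⟨h1, h2, h3⟩
    exact ⟨⟨h1, h2, (dvd_pow_self _ (Nat.succ_ne_zero _)).trans h3⟩,
      (pow_dvd_iff_le_count hN h1 h2 _).1 h3⟩

/-- The reduced digit families whose conductor divides `N`. -/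
noncomputable def box (N : F[X]) : Finset (Digits F) :=
  (positions N).finsupp fun x => (finite_degree_lt x.1.natDegree).toFinset

/-- The digits are chosen independently, with $|P|$ choices at each of the $v_P(N)$ positions over
$P$. -/
theorem card_box {N : F[X]} (hN : N.Monic) : (box N).card = q F ^ N.natDegree := by
  rw [box, Finset.card_finsupp]
  have h : ∀ x : Σ _ : F[X], ℕ,
      (finite_degree_lt (F := F) x.1.natDegree).toFinset.card = q F ^ x.1.natDegree := fun x => by
    rw [← Set.ncard_eq_toFinset_card _ (finite_degree_lt _), ncard_degree_lt]
  simp only [h]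
  rw [Finset.prod_pow_eq_pow_sum, positions, Finset.sum_sigma]
  simp only [Finset.sum_const, Finset.card_range, smul_eq_mul, sum_count_mul_natDegree hN]

theorem mem_box {N : F[X]} (hN : N.Monic) {b : Digits F} :
    b ∈ box N ↔ IsReduced b ∧ conductor b ∣ N := by
  have hdeg : ∀ x : Σ _ : F[X], ℕ, x.1.Monic → x.1.degree = x.1.natDegree := fun x hx =>
    degree_eq_natDegree hx.ne_zero
  rw [box, Finset.mem_finsupp_iff]
  constructor
  · rintro ⟨h1, h2⟩
    have h3 : ∀ x, b x ≠ 0 → x ∈ positions N := fun x hx => h1 (Finsupp.mem_support_iff.2 hx)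
    have hr : IsReduced b := fun x hx => by
      have h4 := (mem_positions hN.ne_zero).1 (h3 x hx)
      refine ⟨h4.1, h4.2.1, ?_⟩
      rw [hdeg x h4.1]
      simpa using h2 x (h3 x hx)
    exact ⟨hr, (hr.conductor_dvd_iff N).2 fun x hx =>
      ((mem_positions hN.ne_zero).1 (h3 x hx)).2.2⟩
  · rintro ⟨h1, h2⟩
    rw [h1.conductor_dvd_iff] at h2
    refine ⟨fun x hx => ?_, fun x hx => ?_⟩
    · rw [Finsupp.mem_support_iff] at hx
      exact (mem_positions hN.ne_zero).2 ⟨(h1 x hx).1, (h1 x hx).2.1, h2 x hx⟩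
    · rw [Set.Finite.mem_toFinset, Set.mem_ofPred_eq]
      by_cases hx0 : b x = 0
      · rw [hx0, degree_zero]; exact WithBot.bot_lt_coe _
      · rw [← hdeg x (h1 x hx0).1]; exact (h1 x hx0).2.2

variable (F) in
/-- The reduced digit families with conductor of degree `d`. -/
noncomputable def digits (d : ℕ) : Finset (Digits F) :=
  ((monics F d).biUnion box).filter fun b => (conductor b).natDegree = d

theorem mem_digits {d : ℕ} {b : Digits F} :
    b ∈ digits F d ↔ IsReduced b ∧ (conductor b).natDegree = d := by
  rw [digits, Finset.mem_filter, Finset.mem_biUnion]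
  constructor
  · rintro ⟨⟨N, hN, hb⟩, hd⟩
    exact ⟨((mem_box (mem_monics.1 hN).1).1 hb).1, hd⟩
  · rintro ⟨hr, hd⟩
    exact ⟨⟨conductor b, mem_monics.2 ⟨hr.monic_conductor, hd⟩,
      (mem_box hr.monic_conductor).2 ⟨hr, dvd_rfl⟩⟩, hd⟩

/-- Counting pairs `(b, N)` with `conductor b ∣ N` and `deg N = n` in two ways. -/
theorem sum_card_digits (n : ℕ) :
    ∑ d ∈ Finset.range (n + 1), (digits F d).card * q F ^ (n - d) = q F ^ (2 * n) := by
  have h1 : ((monics F n).sigma fun N => box N).card = q F ^ (2 * n) := by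
    rw [Finset.card_sigma, Finset.sum_congr rfl fun N hN => by
      rw [card_box (mem_monics.1 hN).1, (mem_monics.1 hN).2], Finset.sum_const, card_monics,
      smul_eq_mul, two_mul, pow_add]
  have h2 : ((Finset.range (n + 1)).sigma fun d => digits F d ×ˢ monics F (n - d)).card =
      ∑ d ∈ Finset.range (n + 1), (digits F d).card * q F ^ (n - d) := by
    rw [Finset.card_sigma]
    simp only [Finset.card_product, card_monics]
  rw [← h1, ← h2]
  -- A multiple $N$ of the conductor is recorded by its monic cofactor, of degree $n-d$.
  refine Finset.card_bij (fun x _ => ⟨conductor x.2.1 * x.2.2, x.2.1⟩) ?_ ?_ ?_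
  · rintro ⟨d, b, D⟩ hx
    simp only [Finset.mem_sigma, Finset.mem_range, Finset.mem_product, mem_digits,
      mem_monics] at hx ⊢
    obtain ⟨hd, ⟨hb, hbd⟩, hD, hDd⟩ := hx
    have hm : (conductor b * D).Monic := hb.monic_conductor.mul hD
    refine ⟨⟨hm, ?_⟩, (mem_box hm).2 ⟨hb, dvd_mul_right _ _⟩⟩
    rw [hb.monic_conductor.natDegree_mul hD, hbd, hDd]
    omega
  · rintro ⟨d, b, D⟩ hx ⟨d', b', D'⟩ hx' h
    simp only [Finset.mem_sigma, Finset.mem_range, Finset.mem_product, mem_digits,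
      mem_monics] at hx hx'
    simp only [Sigma.mk.injEq, heq_eq_eq] at h
    obtain ⟨h1, rfl⟩ := h
    obtain rfl : D = D' := mul_left_cancel₀ hx.2.1.1.monic_conductor.ne_zero h1
    obtain rfl : d = d' := hx.2.1.2.symm.trans hx'.2.1.2
    rfl
  · rintro ⟨N, b⟩ hx
    simp only [Finset.mem_sigma, mem_monics] at hx
    obtain ⟨⟨hN, hNd⟩, hb⟩ := hx
    obtain ⟨hr, D, rfl⟩ := (mem_box hN).1 hb
    have hD : D.Monic := hr.monic_conductor.of_mul_monic_left hN
    have hdeg := hr.monic_conductor.natDegree_mul hD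
    refine ⟨⟨(conductor b).natDegree, b, D⟩, ?_, rfl⟩
    simp only [Finset.mem_sigma, Finset.mem_range, Finset.mem_product, mem_digits, mem_monics]
    exact ⟨by omega, ⟨hr, trivial⟩, hD, by omega⟩

/-! ### The value of a digit expansion -/

/-- The rational function `∑ b ⟨P, i⟩ / P ^ (2 i + 1)`. -/
noncomputable def value (b : Digits F) : RatFunc F :=
  b.sum fun x a => algebraMap F[X] (RatFunc F) a / algebraMap F[X] (RatFunc F) x.1 ^ (2 * x.2 + 1)

omit [Fintype F] in
theorem value_eq_sum {b : Digits F} {S : Finset F[X]} {n : F[X] → ℕ}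
    (h : ∀ x, b x ≠ 0 → x.1 ∈ S ∧ x.2 < n x.1) :
    value b = ∑ P ∈ S, ∑ i ∈ Finset.range (n P), algebraMap F[X] (RatFunc F) (b ⟨P, i⟩) /
      algebraMap F[X] (RatFunc F) P ^ (2 * i + 1) := by
  rw [value, Finsupp.sum_of_support_subset b (s := S.sigma fun P => Finset.range (n P)),
    Finset.sum_sigma]
  · intro x hx
    simpa using h x (Finsupp.mem_support_iff.1 hx)
  · simp

theorem sum_range_two_mul_even {M : Type*} [AddCommMonoid M] (n : ℕ) (f : ℕ → ℕ → M)
    (hf : ∀ j, ¬ Even j → f (j / 2) j = 0) :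
    ∑ j ∈ Finset.range (2 * n), f (j / 2) j = ∑ i ∈ Finset.range n, f i (2 * i) := by
  induction n with
  | zero => simp
  | succ n ih =>
    rw [Finset.sum_range_succ, ← ih, mul_add, mul_one, Finset.sum_range_succ,
      Finset.sum_range_succ, hf (2 * n + 1) (by simp), add_zero, Nat.mul_div_cancel_left _ two_pos]

omit [Fintype F] in
/-- A polynomial and a reduced digit expansion are determined by their sum. -/
theorem value_add_injective {b b' : Digits F} (hb : IsReduced b) (hb' : IsReduced b')
    {f f' : F[X]} (h : value b + algebraMap F[X] (RatFunc F) f =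
      value b' + algebraMap F[X] (RatFunc F) f') : b = b' ∧ f = f' := by
  set S := places b ∪ places b' with hS
  let n : F[X] → ℕ := fun P => max (length b P) (length b' P)
  have hmono : ∀ P ∈ S, P.Monic ∧ Irreducible P := fun P hP =>
    (Finset.mem_union.1 hP).elim hb.of_mem_places hb'.of_mem_places
  have hcov : ∀ x, b x ≠ 0 → x.1 ∈ S ∧ x.2 < n x.1 := fun x hx =>
    ⟨Finset.mem_union_left _ (mem_places.2 ⟨x.2, hx⟩), (lt_length hx).trans_le (le_max_left _ _)⟩
  have hcov' : ∀ x, b' x ≠ 0 → x.1 ∈ S ∧ x.2 < n x.1 := fun x hx =>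
    ⟨Finset.mem_union_right _ (mem_places.2 ⟨x.2, hx⟩), (lt_length hx).trans_le (le_max_right _ _)⟩
  -- Uniqueness of partial fractions concerns all powers $P^{j+1}$; the expansion is padded with
  -- zeros at even powers, that is, at odd $j$.
  let R : Digits F → (P : F[X]) → Fin (2 * n P) → F[X] := fun c P j =>
    if Even j.1 then c ⟨P, j.1 / 2⟩ else 0
  have hval : ∀ c : Digits F, (∀ x, c x ≠ 0 → x.1 ∈ S ∧ x.2 < n x.1) →
      value c = ∑ P ∈ S, ∑ j, algebraMap F[X] (RatFunc F) (R c P j) *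
        (algebraMap F[X] (RatFunc F) P)⁻¹ ^ (j.1 + 1) := by
    intro c hc
    rw [value_eq_sum hc]
    refine Finset.sum_congr rfl fun P _ => ?_
    rw [Fin.sum_univ_eq_sum_range (fun j => algebraMap F[X] (RatFunc F)
      (if Even j then c ⟨P, j / 2⟩ else 0) * (algebraMap F[X] (RatFunc F) P)⁻¹ ^ (j + 1))]
    rw [sum_range_two_mul_even (n P) (fun i j => algebraMap F[X] (RatFunc F)
      (if Even j then c ⟨P, i⟩ else 0) * (algebraMap F[X] (RatFunc F) P)⁻¹ ^ (j + 1))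
      fun j hj => by simp [hj]]
    refine Finset.sum_congr rfl fun i _ => ?_
    simp [div_eq_mul_inv]
  have hdeg : ∀ c : Digits F, IsReduced c → ∀ P ∈ S, ∀ j, (R c P j).degree < P.degree := by
    intro c hc P hP j
    have h0 : (0 : F[X]).degree < P.degree := by
      rw [degree_zero, bot_lt_iff_ne_bot, Ne, degree_eq_bot]
      exact (hmono P hP).1.ne_zero
    simp only [R]
    split_ifs
    · by_cases hx : c ⟨P, j.1 / 2⟩ = 0
      · rwa [hx]
      · exact (hc _ hx).2.2
    · exact h0
  rw [hval b hcov, hval b' hcov', add_comm, add_comm _ (algebraMap F[X] (RatFunc F) f')] at h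
  obtain ⟨hf, hR⟩ := quo_add_sum_rem_mul_pow_inverse_unique (K := RatFunc F) (s := S)
    (g := fun P => P) (fun P hP => (hmono P hP).1)
    (fun P hP Q hQ hne => isCoprime_of_monic_irreducible (hmono P hP).1 (hmono P hP).2
      (hmono Q hQ).1 (hmono Q hQ).2 hne)
    (fun P hP => inv_mul_cancel₀ (by
      rw [Ne, FaithfulSMul.algebraMap_eq_zero_iff]; exact (hmono P hP).1.ne_zero))
    (hdeg b hb) (hdeg b' hb') h
  refine ⟨?_, hf⟩
  ext1 x
  by_cases hx : x.1 ∈ S ∧ x.2 < n x.1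
  · have := congrFun (hR x.1 hx.1) ⟨2 * x.2, by omega⟩
    simpa [R] using this
  · rw [not_imp_comm.1 (hcov x) hx, not_imp_comm.1 (hcov' x) hx]

omit [Fintype F] in
theorem count_normalizedFactors_prod_pow (S : Finset F[X]) (e : F[X] → ℕ)
    (hS : ∀ P ∈ S, P.Monic ∧ Irreducible P) (R : F[X]) :
    (normalizedFactors (∏ P ∈ S, P ^ e P)).count R = if R ∈ S then e R else 0 := by
  have h : normalizedFactors (∏ P ∈ S, P ^ e P) = ∑ P ∈ S, e P • {P} := by
    induction S using Finset.induction_on with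
    | empty => simp
    | insert P S hP ih =>
      have hm := (hS P (by simp)).1
      have hS' : ∀ P ∈ S, P.Monic ∧ Irreducible P := fun R hR => hS R (by simp [hR])
      rw [Finset.prod_insert hP, Finset.sum_insert hP, normalizedFactors_mul
        (pow_ne_zero _ hm.ne_zero) (Finset.prod_ne_zero_iff.2 fun R hR =>
          pow_ne_zero _ (hS' R hR).1.ne_zero), ih hS', normalizedFactors_pow,
        normalizedFactors_irreducible (hS P (by simp)).2, hm.normalize_eq_self]
  rw [h, Multiset.count_sum']
  simp only [Multiset.count_nsmul, Multiset.count_singleton]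
  simp

omit [Fintype F] in
theorem natDegree_tPoly {M : F[X]} (hM : M.Monic) :
    (tPoly M).natDegree =
      ∑ P ∈ primeDivisors M, ((normalizedFactors M).count P + 1) * P.natDegree := by
  have hm : ∀ P ∈ primeDivisors M, P.Monic := fun P hP =>
    ((mem_primeDivisors hM.ne_zero).1 hP).1
  have hrad : (rad M).Monic := monic_prod_of_monic _ _ hm
  rw [tPoly, hM.natDegree_mul hrad, rad, natDegree_prod_of_monic _ _ hm,
    ← sum_count_mul_natDegree hM, ← Finset.sum_add_distrib]
  exact Finset.sum_congr rfl fun P _ => by ring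

omit [Fintype F] in
theorem sum_Icc_digits (A : ℕ → F[X]) (P : F[X]) (n : ℕ) :
    ∑ i ∈ Finset.Icc 1 n, algebraMap F[X] (RatFunc F) (A i) /
      algebraMap F[X] (RatFunc F) P ^ (2 * i - 1) =
    ∑ i ∈ Finset.range n, algebraMap F[X] (RatFunc F) (A (i + 1)) /
      algebraMap F[X] (RatFunc F) P ^ (2 * i + 1) := by
  rw [← Finset.Ico_add_one_right_eq_Icc, Finset.sum_Ico_eq_sum_range]
  refine Finset.sum_congr (by simp) fun i _ => ?_
  rw [add_comm 1 i, show 2 * (i + 1) - 1 = 2 * i + 1 by omega]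

-- Via `natDegree_tPoly`, this turns the condition $\deg t(M)=2n$ into $\deg\prod P^{\ell_P}=n$, a
-- condition on the conductor.
omit [Fintype F] in
theorem two_mul_ell {M : F[X]} (hM : M ∈ calB F) {P : F[X]} (hP : P ∈ primeDivisors M) :
    2 * ell M P = (normalizedFactors M).count P + 1 := by
  obtain ⟨h1, h2, h3⟩ := (mem_primeDivisors hM.1.ne_zero).1 hP
  have hc := multiplicity_eq_count hM.1.ne_zero h1 h2
  have hpos : 1 ≤ (normalizedFactors M).count P :=
    (pow_dvd_iff_le_count hM.1.ne_zero h1 h2 1).1 (by simpa using h3)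
  rcases hM.2 P h1 h2 with h | ⟨m, hm⟩
  · omega
  · rw [ell]; omega

/-- Rational functions of the family are values of digit expansions. -/
theorem exists_digits_of_mem_calFM {M : F[X]} {n : ℕ} (hM : M ∈ calBn F n) {u : RatFunc F}
    (hu : u ∈ calFM M) : ∃ b ∈ digits F n, value b = u := by
  obtain ⟨hB, hdeg⟩ := hM
  obtain ⟨A, hA1, hA2, rfl⟩ := hu
  have hell : ∀ P ∈ primeDivisors M, 1 ≤ ell M P := fun P hP => by
    have := two_mul_ell hB hP
    omega
  set T : Finset (Σ _ : F[X], ℕ) := (primeDivisors M).sigma fun P => Finset.range (ell M P)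
    with hT
  have hTmem : ∀ x, x ∈ T ↔ x.1 ∈ primeDivisors M ∧ x.2 < ell M x.1 := fun x => by simp [hT]
  -- Digits are indexed from $0$ but the $A_{P,i}$ from $1$, hence the shift.
  let b : Digits F := Finsupp.onFinset T (fun x => if x ∈ T then A x.1 (x.2 + 1) else 0)
    fun x hx => by by_contra h; simp [h] at hx
  have hbT : ∀ x ∈ T, b x = A x.1 (x.2 + 1) := fun x hx => by simp [b, hx]
  have hb0 : ∀ x, b x ≠ 0 → x ∈ T := fun x hx => by
    by_contra h; simp [b, h] at hx
  have htop : ∀ P ∈ primeDivisors M, b ⟨P, ell M P - 1⟩ ≠ 0 := fun P hP => by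
    have := hell P hP
    rw [hbT _ ((hTmem _).2 ⟨hP, by dsimp only; omega⟩)]
    dsimp only
    rw [Nat.sub_add_cancel this]
    exact hA2 P hP
  have hplaces : places b = primeDivisors M := by
    ext P
    rw [mem_places]
    constructor
    · rintro ⟨i, hi⟩
      exact ((hTmem _).1 (hb0 _ hi)).1
    · intro hP
      exact ⟨_, htop P hP⟩
  have hlen : ∀ P ∈ primeDivisors M, length b P = ell M P := fun P hP => by
    have h1 := lt_length (htop P hP)
    obtain ⟨i, hi, hl⟩ := exists_length_eq (b := b) (P := P) (by rwa [hplaces])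
    have h2 := ((hTmem _).1 (hb0 _ hi)).2
    dsimp only at h1 h2
    omega
  have hred : IsReduced b := fun x hx => by
    have hxT := hb0 x hx
    obtain ⟨h1, h2⟩ := (hTmem x).1 hxT
    obtain ⟨h3, h4, -⟩ := (mem_primeDivisors hB.1.ne_zero).1 h1
    refine ⟨h3, h4, ?_⟩
    rw [hbT x hxT]
    exact hA1 _ h1 _ (Finset.mem_Icc.2 ⟨by omega, h2⟩)
  refine ⟨b, mem_digits.2 ⟨hred, ?_⟩, ?_⟩
  · have hm : ∀ P ∈ primeDivisors M, P.Monic := fun P hP =>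
      ((mem_primeDivisors hB.1.ne_zero).1 hP).1
    rw [natDegree_tPoly hB.1] at hdeg
    have h2 : ∑ P ∈ primeDivisors M, ((normalizedFactors M).count P + 1) * P.natDegree =
        2 * (conductor b).natDegree := by
      rw [conductor, hplaces, natDegree_prod_of_monic _ _ fun P hP => (hm P hP).pow _,
        Finset.mul_sum]
      refine Finset.sum_congr rfl fun P hP => ?_
      rw [(hm P hP).natDegree_pow, hlen P hP, ← two_mul_ell hB hP]
      ring
    omega
  · rw [value_eq_sum (S := primeDivisors M) (n := ell M) fun x hx => (hTmem x).1 (hb0 x hx)]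
    refine Finset.sum_congr rfl fun P hP => ?_
    rw [sum_Icc_digits]
    refine Finset.sum_congr rfl fun i hi => ?_
    have hx : (⟨P, i⟩ : Σ _ : F[X], ℕ) ∈ T := (hTmem ⟨P, i⟩).2 ⟨hP, Finset.mem_range.1 hi⟩
    rw [hbT ⟨P, i⟩ hx]

theorem value_mem_calF {b : Digits F} {n : ℕ} (hn : n ≠ 0) (hb : b ∈ digits F n) :
    value b ∈ calF F n := by
  obtain ⟨hred, hdeg⟩ := mem_digits.1 hb
  have hS := fun P (hP : P ∈ places b) => hred.of_mem_places hP
  -- Odd exponents chosen so that $(v_P(M)+1)/2$ recovers the length at $P$.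
  set M := ∏ P ∈ places b, P ^ (2 * length b P - 1) with hMdef
  have hM : M.Monic := monic_prod_of_monic _ _ fun P hP => (hS P hP).1.pow _
  have hcount := count_normalizedFactors_prod_pow (places b) (fun P => 2 * length b P - 1) hS
  rw [← hMdef] at hcount
  have hlen : ∀ P ∈ places b, 1 ≤ length b P := fun P hP => by
    obtain ⟨i, -, h⟩ := exists_length_eq hP
    omega
  have hpd : primeDivisors M = places b := by
    ext P
    rw [primeDivisors, Multiset.mem_toFinset, ← Multiset.count_ne_zero, hcount]
    constructor
    · intro h
      by_contra h'
      simp [h'] at h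
    · intro h
      have := hlen P h
      rw [if_pos h]
      omega
  have hB : M ∈ calB F := by
    refine ⟨hM, fun P hP hi => ?_⟩
    rw [multiplicity_eq_count hM.ne_zero hP hi, hcount]
    by_cases h : P ∈ places b
    · have := hlen P h
      rw [if_pos h]
      exact Or.inr ⟨length b P - 1, by omega⟩
    · simp [h]
  have hell : ∀ P ∈ places b, ell M P = length b P := fun P hP => by
    have h1 := two_mul_ell hB (hpd ▸ hP)
    have := hlen P hP
    rw [hcount, if_pos hP] at h1
    omega
  have hBn : M ∈ calBn F n := by
    refine ⟨hB, ?_⟩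
    rw [natDegree_tPoly hM, ← hdeg, conductor,
      natDegree_prod_of_monic _ _ fun P hP => (hS P hP).1.pow _, Finset.mul_sum, hpd]
    refine Finset.sum_congr rfl fun P hP => ?_
    rw [(hS P hP).1.natDegree_pow, ← two_mul_ell hB (hpd ▸ hP), hell P hP]
    ring
  rw [calF, if_neg hn]
  refine Set.mem_biUnion hBn ⟨fun P i => b ⟨P, i - 1⟩, ?_, ?_, ?_⟩
  · intro P hP i _
    rw [hpd] at hP
    beta_reduce
    by_cases h : b ⟨P, i - 1⟩ = 0
    · rw [h, degree_zero, bot_lt_iff_ne_bot, Ne, degree_eq_bot]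
      exact (hS P hP).1.ne_zero
    · exact (hred _ h).2.2
  · intro P hP
    rw [hpd] at hP
    obtain ⟨i, hi, hl⟩ := exists_length_eq hP
    rw [hell P hP, hl]
    exact hi
  · rw [hpd, value_eq_sum (S := places b) (n := length b) fun x hx =>
      ⟨mem_places.2 ⟨x.2, hx⟩, lt_length hx⟩]
    refine Finset.sum_congr rfl fun P hP => ?_
    rw [sum_Icc_digits, hell P hP]
    rfl

theorem digits_zero : digits F 0 = {0} := by
  ext b
  rw [mem_digits, Finset.mem_singleton]
  constructor
  · rintro ⟨hred, hdeg⟩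
    ext1 x
    by_contra hx
    have h1 := (hred.conductor_dvd_iff (conductor b)).1 dvd_rfl x hx
    have h2 := natDegree_le_of_dvd ((dvd_pow_self _ (Nat.succ_ne_zero _)).trans h1)
      hred.monic_conductor.ne_zero
    have h3 := (hred x hx).2.1.natDegree_pos
    omega
  · rintro rfl
    refine ⟨fun x hx => absurd rfl hx, ?_⟩
    simp [conductor, places]

theorem calF_eq_image (n : ℕ) : calF F n = value '' (digits F n : Set (Digits F)) := by
  rcases eq_or_ne n 0 with rfl | hn
  · simp [calF, digits_zero, value]
  · ext u
    constructor
    · intro hu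
      rw [calF, if_neg hn, Set.mem_iUnion₂] at hu
      obtain ⟨M, hM, hu⟩ := hu
      obtain ⟨b, hb, rfl⟩ := exists_digits_of_mem_calFM hM hu
      exact ⟨b, hb, rfl⟩
    · rintro ⟨b, hb, rfl⟩
      exact value_mem_calF hn hb

/-! ### The polynomial part -/

/-- `α + ∑ a_i T^{2i+1}`. -/
noncomputable def oddPoly {t : ℕ} (x : F × (Fin (t + 1) → F)) : F[X] :=
  C x.1 + ∑ i : Fin (t + 1), C (x.2 i) * X ^ (2 * (i : ℕ) + 1)

omit [Fintype F] in
theorem oddPoly_injective (t : ℕ) : Function.Injective (oddPoly (F := F) (t := t)) := by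
  have h0 : ∀ x : F × (Fin (t + 1) → F), (oddPoly x).coeff 0 = x.1 := fun x => by
    simp [oddPoly, coeff_X_pow]
  have h1 : ∀ (x : F × (Fin (t + 1) → F)) (i : Fin (t + 1)),
      (oddPoly x).coeff (2 * (i : ℕ) + 1) = x.2 i := fun x i => by
    simp only [oddPoly, coeff_add, finsetSum_coeff, coeff_C_mul, coeff_X_pow, coeff_C]
    simp [Fin.val_inj]
  intro x y h
  refine Prod.ext ?_ (funext fun i => ?_)
  · rw [← h0 x, h, h0]
  · rw [← h1 x, h, h1]

/-- The admissible coefficients of the polynomial part. -/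
noncomputable def polyParams (ξ : F) (t : ℕ) : Finset (F × (Fin (t + 1) → F)) :=
  {0, ξ} ×ˢ Fintype.piFinset fun i : Fin (t + 1) =>
    if i = Fin.last t then Finset.univ.erase 0 else Finset.univ

theorem card_polyParams {ξ : F} (hξ : ξ ≠ 0) (t : ℕ) :
    (polyParams ξ t).card = 2 * ((q F - 1) * q F ^ t) := by
  rw [polyParams, Finset.card_product, Finset.card_pair hξ.symm, Fintype.card_piFinset,
    Fin.prod_univ_castSucc]
  simp [q, mul_comm, (Fin.castSucc_lt_last _).ne]

theorem calG_eq_image (ξ : F) (t : ℕ) :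
    calG ξ (t + 1) = oddPoly '' (polyParams ξ t : Set (F × (Fin (t + 1) → F))) := by
  have hsum : ∀ a : ℕ → F, ∑ i ∈ Finset.Icc 1 (t + 1), C (a i) * X ^ (2 * i - 1) =
      ∑ i : Fin (t + 1), C (a (i + 1)) * (X : F[X]) ^ (2 * (i : ℕ) + 1) := fun a => by
    rw [Fin.sum_univ_eq_sum_range (fun i => C (a (i + 1)) * (X : F[X]) ^ (2 * i + 1)),
      ← Finset.Ico_add_one_right_eq_Icc, Finset.sum_Ico_eq_sum_range]
    refine Finset.sum_congr (by simp) fun i _ => ?_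
    rw [add_comm 1 i, show 2 * (i + 1) - 1 = 2 * i + 1 by omega]
  ext f
  constructor
  · rintro ⟨α, a, hα, ha, rfl⟩
    refine ⟨(α, fun i => a (i + 1)), ?_, by rw [hsum]; rfl⟩
    simp only [polyParams, Finset.coe_product, Set.mem_prod, Finset.mem_coe,
      Fintype.mem_piFinset]
    refine ⟨by simpa using hα, fun i => ?_⟩
    split_ifs with h
    · subst h; simpa using ha
    · simp
  · rintro ⟨⟨α, a⟩, hx, rfl⟩
    simp only [polyParams, Finset.coe_product, Set.mem_prod, Finset.mem_coe,
      Fintype.mem_piFinset] at hx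
    refine ⟨α, fun i => if h : i - 1 < t + 1 then a ⟨i - 1, h⟩ else 0, by simpa using hx.1, ?_, ?_⟩
    · have := hx.2 (Fin.last t)
      simpa [Fin.last] using this
    · rw [hsum]
      refine congrArg (C α + ·) (Finset.sum_congr rfl fun i _ => ?_)
      simp [Nat.lt_succ_iff.1 i.2]

/-! ### The size of the family. -/

/-- The exact number of elements of the family. -/
theorem calI_finite_and_ncard {ξ : F} (hξ : ξ ≠ 0) (g : ℕ) :
    (calI ξ (g + 1)).Finite ∧ (calI ξ (g + 1)).ncard = 2 * (q F - 1) * q F ^ (2 * g) := by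
  let T : Finset (Σ r : ℕ, Digits F × (F × (Fin (g - r + 1) → F))) :=
    (Finset.range (g + 1)).sigma fun r => digits F r ×ˢ polyParams ξ (g - r)
  let v : (Σ r : ℕ, Digits F × (F × (Fin (g - r + 1) → F))) → RatFunc F := fun x =>
    value x.2.1 + algebraMap F[X] (RatFunc F) (oddPoly x.2.2)
  have himage : calI ξ (g + 1) = v '' (T : Set _) := by
    ext w
    constructor
    · rintro ⟨r, s, hs, hrs, u, hu, f, hf, rfl⟩
      obtain rfl : s = g - r + 1 := by omega
      rw [calF_eq_image] at hu
      rw [calG_eq_image] at hf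
      obtain ⟨b, hb, rfl⟩ := hu
      obtain ⟨p, hp, rfl⟩ := hf
      refine ⟨⟨r, b, p⟩, ?_, rfl⟩
      simp only [T, Finset.coe_sigma, Set.mem_sigma_iff, Finset.mem_coe, Finset.mem_range,
        Finset.mem_product]
      exact ⟨by omega, hb, hp⟩
    · rintro ⟨⟨r, b, p⟩, hx, rfl⟩
      simp only [T, Finset.coe_sigma, Set.mem_sigma_iff, Finset.mem_coe, Finset.mem_range,
        Finset.mem_product] at hx
      refine ⟨r, g - r + 1, by omega, by omega, value b, ?_, oddPoly p, ?_, rfl⟩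
      · rw [calF_eq_image]; exact ⟨b, hx.2.1, rfl⟩
      · rw [calG_eq_image]; exact ⟨p, hx.2.2, rfl⟩
  have hinj : Set.InjOn v (T : Set _) := by
    rintro ⟨r, b, p⟩ hx ⟨r', b', p'⟩ hx' h
    simp only [T, Finset.coe_sigma, Set.mem_sigma_iff, Finset.mem_coe, Finset.mem_range,
      Finset.mem_product] at hx hx'
    obtain ⟨h1, h2⟩ := mem_digits.1 hx.2.1
    obtain ⟨h1', h2'⟩ := mem_digits.1 hx'.2.1
    obtain ⟨rfl, hf⟩ := value_add_injective h1 h1' h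
    obtain rfl : r = r' := h2.symm.trans h2'
    obtain rfl := oddPoly_injective _ hf
    rfl
  refine ⟨himage ▸ T.finite_toSet.image v, ?_⟩
  rw [himage, hinj.ncard_image, Set.ncard_coe_finset, Finset.card_sigma]
  simp only [Finset.card_product, card_polyParams hξ]
  -- The polynomial parts paired with $\mathcal F_r$ number $2(q-1)q^{g-r}$, so the weights match
  -- the convolution identity and no single $|\mathcal F_r|$ need be known.
  rw [← sum_card_digits, Finset.mul_sum]
  exact Finset.sum_congr rfl fun r _ => by ring

/-! ### Central Euler factors and the final asymptotics. -/

/-- The Euler factor at the central point in terms of `y = |P|^{-1/2}`. -/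
theorem eulerFactor_zero_eq (k : ℕ) (P : MonicPrime F) :
    ∃ y : ℂ, y ≠ 0 ∧ (pnorm P.1 : ℂ) = 1 / y ^ 2 ∧ 1 - y ≠ 0 ∧ 1 + y ≠ 0 ∧ 1 + y ^ 2 ≠ 0 ∧
      eulerFactor (0 : Fin k → ℂ) P = (1 - y ^ 2) ^ (k * (k + 1) / 2) *
        (1 / 2 * ((1 - y)⁻¹ ^ k + (1 + y)⁻¹ ^ k) + y ^ 2) * (1 + y ^ 2)⁻¹ := by
  have hN2 := two_le_pnorm P
  have hN : (pnorm P.1 : ℂ) ≠ 0 := by exact_mod_cast (by omega : pnorm P.1 ≠ 0)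
  set y : ℂ := 1 / (pnorm P.1 : ℂ) ^ (1 / 2 : ℂ) with hy
  have hsq : ((pnorm P.1 : ℂ) ^ (1 / 2 : ℂ)) ^ 2 = pnorm P.1 := by
    rw [← Complex.cpow_nat_mul]
    norm_num
  have hy2 : y ^ 2 = 1 / pnorm P.1 := by rw [hy, div_pow, hsq, one_pow]
  have hy0 : y ≠ 0 := by
    intro h
    rw [h, zero_pow two_ne_zero, eq_comm, one_div, inv_eq_zero] at hy2
    exact hN hy2
  have hN1 : (pnorm P.1 : ℂ) - 1 ≠ 0 := by
    rw [sub_ne_zero]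
    exact_mod_cast (by omega : pnorm P.1 ≠ 1)
  have hN3 : (pnorm P.1 : ℂ) + 1 ≠ 0 := by exact_mod_cast (by omega : pnorm P.1 + 1 ≠ 0)
  have h1 : (1 - y) * (1 + y) ≠ 0 := by
    have : (1 - y) * (1 + y) = ((pnorm P.1 : ℂ) - 1) / pnorm P.1 := by
      rw [sub_div, div_self hN, ← hy2]; ring
    rw [this]
    exact div_ne_zero hN1 hN
  refine ⟨y, hy0, by rw [hy2, one_div_one_div], left_ne_zero_of_mul h1, right_ne_zero_of_mul h1,
    ?_, ?_⟩
  · have : 1 + y ^ 2 = ((pnorm P.1 : ℂ) + 1) / pnorm P.1 := by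
      rw [add_div, div_self hN, ← hy2]
    rw [this]
    exact div_ne_zero hN3 hN
  · have hloc : localParam (0 : Fin k → ℂ) P = fun _ => y := by
      ext j; simp [localParam, hy]
    rw [eulerFactor_eq, hloc, ← hy2, ← prod_prod_Ici_const]
    simp [pairProd, evenPart, pow_two]

theorem eulerFactor_zero_four (P : MonicPrime F) : eulerFactor (0 : Fin 4 → ℂ) P =
    1 - h4 (pnorm P.1) / ((pnorm P.1 : ℂ) ^ 10 * ((pnorm P.1 : ℂ) + 1)) := by
  obtain ⟨y, h0, hN, h1, h2, h3, h⟩ := eulerFactor_zero_eq 4 P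
  rw [h, hN, h4]
  have h5 : 1 - y ^ 2 = (1 - y) * (1 + y) := by ring
  have h6 : 1 / y ^ 2 + 1 = (1 + y ^ 2) / y ^ 2 := by field_simp
  rw [h5, h6]
  norm_num
  field_simp
  ring

theorem eulerFactor_zero_five (P : MonicPrime F) : eulerFactor (0 : Fin 5 → ℂ) P =
    1 - h5 (pnorm P.1) / ((pnorm P.1 : ℂ) ^ 15 * ((pnorm P.1 : ℂ) + 1)) := by
  obtain ⟨y, h0, hN, h1, h2, h3, h⟩ := eulerFactor_zero_eq 5 P
  rw [h, hN, h5]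
  have h5 : 1 - y ^ 2 = (1 - y) * (1 + y) := by ring
  have h6 : 1 / y ^ 2 + 1 = (1 + y ^ 2) / y ^ 2 := by field_simp
  rw [h5, h6]
  norm_num
  field_simp
  ring

/-- The size of the family in terms of `ζ_A(2)`. -/
theorem ncard_calI_cast {ξ : F} (hξ : ξ ≠ 0) (g : ℕ) :
    ((calI ξ (g + 1)).ncard : ℂ) = 2 * ((q F : ℂ) ^ (2 * g + 1) / zetaA F 2) := by
  have hq : (q F : ℂ) ≠ 0 := by
    have := two_le_q (F := F)
    exact_mod_cast (by omega : q F ≠ 0)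
  rw [(calI_finite_and_ncard hξ g).2, zetaA, div_inv_eq_mul, show (1 : ℂ) - 2 = -1 by norm_num,
    Complex.cpow_neg_one]
  have : ((q F - 1 : ℕ) : ℂ) = q F - 1 := by
    rw [Nat.cast_sub (by have := two_le_q (F := F); omega), Nat.cast_one]
  push_cast
  rw [this]
  field_simp
  ring

/-- The conjectured main term is the family size times $Q_k(2g+1)$. Nonvanishing of $A$ at the
centre lets the limit of $Q_k/g^{k(k+1)/2}$ be upgraded to an asymptotic equivalence. -/
theorem moment_isEquivalent {ξ : F} (hξ : ξ ≠ 0) {k : ℕ} (hk : 1 ≤ k) {r : ℝ} (hr0 : 0 < r)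
    (hr1 : r < 1 / 4) (hr2 : r < Real.pi / Real.log (q F)) (h : MomentConjecture ξ k r) :
    (fun g : ℕ => moment ξ k g) ~[atTop] fun g : ℕ =>
      2 ^ (k * (k + 1) / 2 + 1) * ((q F : ℂ) ^ (2 * g + 1) / zetaA F 2) *
        (g : ℂ) ^ (k * (k + 1) / 2) * A F (0 : Fin k → ℂ) *
        ∏ j ∈ Finset.Icc 1 k, ((j ! : ℂ) / ((2 * j)! : ℂ)) := by
  refine h.trans ?_
  set c : ℂ := A F (0 : Fin k → ℂ) *
    (2 ^ (k * (k + 1) / 2) * ∏ j ∈ Finset.Icc 1 k, ((j ! : ℂ) / ((2 * j)! : ℂ))) with hc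
  have hc0 : c ≠ 0 := by
    refine mul_ne_zero A_zero_ne_zero (mul_ne_zero (pow_ne_zero _ two_ne_zero)
      (Finset.prod_ne_zero_iff.2 fun j _ => div_ne_zero ?_ ?_))
    all_goals exact_mod_cast Nat.factorial_ne_zero _
  have hQ : (fun g : ℕ => Q F k r (2 * (g : ℂ) + 1)) ~[atTop]
      fun g : ℕ => c * (g : ℂ) ^ (k * (k + 1) / 2) := by
    have h1 := (isEquivalent_const_iff_tendsto hc0).2 (tendsto_Q_div (F := F) hk hr0 hr1 hr2)
    have h2 := h1.mul (IsEquivalent.refl (u := fun g : ℕ => (g : ℂ) ^ (k * (k + 1) / 2)))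
    refine h2.congr_left ?_
    filter_upwards [eventually_gt_atTop 0] with g hg
    have hg0 : (g : ℂ) ^ (k * (k + 1) / 2) ≠ 0 := pow_ne_zero _ (by exact_mod_cast hg.ne')
    simp [div_mul_cancel₀ _ hg0]
  have hI := (IsEquivalent.refl (l := atTop)
    (u := fun g : ℕ => ((calI ξ (g + 1)).ncard : ℂ))).mul hQ
  refine (hI.congr_left ?_).congr_right ?_
  · refine Eventually.of_forall fun g => ?_
    have hfin := (calI_finite_and_ncard hξ g).1
    simp only [Pi.mul_apply]
    rw [finsum_mem_eq_finite_toFinset_sum _ hfin, Finset.sum_const,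
      ← Set.ncard_eq_toFinset_card _ hfin, nsmul_eq_mul]
  · refine Eventually.of_forall fun g => ?_
    simp only [Pi.mul_apply, ncard_calI_cast hξ, hc]
    ring

end EvenCharMoments

open EvenCharMoments in
theorem theorem6p2 (F : Type*) [Field F] [Fintype F] [CharP F 2]
    (ξ : F) (hξ : ∀ x : F, x ^ 2 + x ≠ ξ)
    (r : ℝ) (hr0 : 0 < r) (hr1 : r < 1 / 4) (hr2 : r < Real.pi / Real.log (q F)) :
    -- the general moment
    (∀ k : ℕ, 1 ≤ k →
      Multipliable (fun P : MonicPrime F => eulerFactor (0 : Fin k → ℂ) P) ∧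
      (MomentConjecture ξ k r →
        (fun g : ℕ => moment ξ k g) ~[atTop] fun g : ℕ =>
          2 ^ (k * (k + 1) / 2 + 1) * ((q F : ℂ) ^ (2 * g + 1) / zetaA F 2) *
            (g : ℂ) ^ (k * (k + 1) / 2) * A F (0 : Fin k → ℂ) *
            ∏ j ∈ Finset.Icc 1 k, ((j ! : ℂ) / ((2 * j)! : ℂ)))) ∧
    -- the fourth moment
    (MomentConjecture ξ 4 r →
      (fun g : ℕ => moment ξ 4 g) ~[atTop] fun g : ℕ =>
        2 / 4725 * ((q F : ℂ) ^ (2 * g + 1) / zetaA F 2) * (g : ℂ) ^ 10 *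
          A F (0 : Fin 4 → ℂ)) ∧
    (A F (0 : Fin 4 → ℂ) = ∏' P : MonicPrime F,
      (1 - h4 (pnorm P.1) / ((pnorm P.1 : ℂ) ^ 10 * ((pnorm P.1 : ℂ) + 1)))) ∧
    -- the fifth moment
    (MomentConjecture ξ 5 r →
      (fun g : ℕ => moment ξ 5 g) ~[atTop] fun g : ℕ =>
        2 / 4465125 * ((q F : ℂ) ^ (2 * g + 1) / zetaA F 2) * (g : ℂ) ^ 15 *
          A F (0 : Fin 5 → ℂ)) ∧
    (A F (0 : Fin 5 → ℂ) = ∏' P : MonicPrime F,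
      (1 - h5 (pnorm P.1) / ((pnorm P.1 : ℂ) ^ 15 * ((pnorm P.1 : ℂ) + 1)))) := by
  -- Since $0=0^2+0$; this makes $\{0,\xi\}$ a set of two elements in the count.
  have hξ0 : ξ ≠ 0 := fun h => hξ 0 (by simp [h])
  have hmain : ∀ k : ℕ, 1 ≤ k → MomentConjecture ξ k r → _ := fun k hk h =>
    moment_isEquivalent hξ0 hk hr0 hr1 hr2 h
  refine ⟨fun k hk => ⟨multipliable_eulerFactor hr0.le hr1 (by simp [hr0.le]), hmain k hk⟩,
    fun h => ?_, ?_, fun h => ?_, ?_⟩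
  · refine (hmain 4 (by norm_num) h).congr_right (Eventually.of_forall fun g => ?_)
    simp [Finset.prod_Icc_succ_top, Nat.factorial]
    ring
  · exact tprod_congr eulerFactor_zero_four
  · refine (hmain 5 (by norm_num) h).congr_right (Eventually.of_forall fun g => ?_)
    simp [Finset.prod_Icc_succ_top, Nat.factorial]
    ring
  · exact tprod_congr eulerFactor_zero_five
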